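/- **Conventions.** All Lie algebras are real and finite-dimensional. A pseudo-Riemannian Lie algebra is a Lie algebra $\mathfrak g$ with a nondegenerate symmetric bilinear form $\langle\;,\;\rangle$; it is Riemannian if the form is positive definite and Lorentzian if the form has signature $(-,+,\dots,+)$. Its Levi-Civita product $(u,v)\mapsto uv$ is defined by $$2\langle uv,w\rangle=\langle[u,v],w\rangle+\langle[w,u],v\rangle+\langle[w,v],u\rangle\qquad(u,v,w\in\mathfrak g);$$ put $\mathrm L_uv=uv$ and $\mathrm R_uv=vu$. The pseudo-Riemannian Lie algebra is flat if $\mathrm L_{[u,v]}=[\mathrm L_u,\mathrm L_v]$ for all $u,v$. Its center $Z(\mathfrak g)$ is degenerate if the restriction of $\langle\;,\;\rangle$ to $Z(\mathfrak g)$ is degenerate. $\mathfrak g$ is unimodular if $\mathrm{tr}(\mathrm{ad}_u)=0$ for all $u\in\mathfrak g$, and $(\mathfrak g,\langle\;,\;\rangle)$ is complete if the corresponding left-invariant pseudo-Riemannian metric on any Lie group with Lie algebra $\mathfrak g$ is geodesically complete. Let $(B,[\;,\;]_0,\langle\;,\;\rangle_0)$ be a pseudo-Riemannian flat Lie algebra,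 $\xi,D$ endomorphisms of $B$, $\mu\in\mathbb R$ and $b_0\in B$. The quadruple $(\xi,D,\mu,b_0)$ is admissible if $D$ is a derivation of $B$, $D-\xi$ is skew-symmetric with respect to $\langle\;,\;\rangle_0$, $[D,\xi]=\xi^2-\mu\xi-\mathrm R_{b_0}$, and for all $a,b\in B$ $$\xi([a,b]_0)=\mathrm L_a\xi(b)-\mathrm L_b\xi(a),\qquad a\xi(b)-\xi(ab)=D(a)b+aD(b)-D(ab).$$ The double extension of $B$ according to the admissible quadruple $(\xi,D,\mu,b_0)$ is the vector space $\mathbb Rz\oplus B\oplus\mathbb R\bar z$ with the inner product that extends $\langle\;,\;\rangle_0$, for which $B$ is orthogonal to $\mathrm{span}\{z,\bar z\}$, $\langle z,z\rangle=\langle\bar z,\bar z\rangle=0$ and $\langle z,\bar z\rangle=1$, and with the bracket $$[\bar z,z]=\mu z,\qquad[\bar z,a]=D(a)-\langle b_0,a\rangle_0z,\qquad[a,b]=[a,b]_0+\langle(\xi-\xi^*)(a),b\rangle_0z\qquad(a,b\in B),$$ where $\xi^*$ is the adjoint of $\xi$ with respect to $\langle\;,\;\rangle_0$. A pseudo-Riemannian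 Lie algebra is said to be a double extension if it is isometrically isomorphic to one of these. **Theorem 2.1.** Let $(\mathfrak g,\langle\;,\;\rangle)$ be a Lorentzian Lie algebra whose center is degenerate. Then $\mathfrak g$ is flat if and only if it is a double extension of a Riemannian flat Lie algebra $(B,[\;,\;]_0,\langle\;,\;\rangle_0)$ according to an admissible quadruple $(\xi,D,0,b_0)$ with $(D,b_0)\neq(0,0)$. Moreover, if $\mathfrak g$ is flat, then it is unimodular and complete. -/

import Mathlib

open scoped Manifold ContDiff

universe u v

noncomputable section

section Instances

variable {n : ℕ} {G : Type*} [TopologicalSpace G] [ChartedSpace (EuclideanSpace ℝ (Fin n)) G]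
  [Group G] [LieGroup (𝓡 n) ∞ G]

/-- A smooth real Lie group is regular enough for Mathlib's Lie algebra structure on `T₁G`. -/
instance lieGroupMinSmoothness : LieGroup (𝓡 n) (minSmoothness ℝ 3) G := by
  rw [minSmoothness_of_isRCLikeNormedField]
  infer_instance

instance finiteDimensionalGroupLieAlgebra : FiniteDimensional ℝ (GroupLieAlgebra (𝓡 n) G) :=
  inferInstanceAs (FiniteDimensional ℝ (EuclideanSpace ℝ (Fin n)))

end Instances

/-- A pseudo-Riemannian metric (an "inner product" of arbitrary signature) on a real vector space:
a nondegenerate symmetric bilinear form. A finite-dimensional real Lie algebra together with such a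
form is a pseudo-Riemannian Lie algebra. -/
structure LieMetric (V : Type*) [AddCommGroup V] [Module ℝ V] where
  /-- the bilinear form `⟨ , ⟩` -/
  form : LinearMap.BilinForm ℝ V
  symm : form.IsSymm
  nondegenerate : form.Nondegenerate

namespace LieMetric

section LinearAlgebra

variable {V : Type*} [AddCommGroup V] [Module ℝ V]

/-- The metric is positive definite. -/
def IsRiemannian (m : LieMetric V) : Prop :=
  ∀ v : V, v ≠ 0 → 0 < m.form v v

/-- The metric has signature `(-, +, …, +)`: in some basis its matrix is `diag(-1, 1, …, 1)`. -/
def IsLorentzian (m : LieMetric V) : Prop :=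
  ∃ (n : ℕ) (e : Module.Basis (Fin (n + 1)) ℝ V), ∀ i j : Fin (n + 1),
    m.form (e i) (e j) = if i = j then (if i = 0 then -1 else 1) else 0

/-- An endomorphism `A` is skew-symmetric: `⟨A u, v⟩ = -⟨u, A v⟩`. -/
def IsSkew (m : LieMetric V) (A : Module.End ℝ V) : Prop :=
  ∀ u v : V, m.form (A u) v = -m.form u (A v)

end LinearAlgebra

section Lie

variable {g : Type*} [LieRing g] [LieAlgebra ℝ g]

/-- The center `Z(g)` is degenerate: the restriction of the metric to `Z(g)` is a degenerate
bilinear form. -/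
def HasDegenerateCenter (m : LieMetric g) : Prop :=
  ¬ (m.form.restrict (LieAlgebra.center ℝ g).toSubmodule).Nondegenerate

/-- The linear form `w ↦ ½ (⟨[u,v],w⟩ + ⟨[w,u],v⟩ + ⟨[w,v],u⟩)` of the Koszul formula. -/
def koszul (m : LieMetric g) (u v : g) : Module.Dual ℝ g where
  toFun w := (1 / 2 : ℝ) * (m.form ⁅u, v⁆ w + m.form ⁅w, u⁆ v + m.form ⁅w, v⁆ u)
  map_add' w w' := by simp only [add_lie, map_add, LinearMap.add_apply]; ring
  map_smul' c w := by
    simp only [smul_lie, map_smul, LinearMap.smul_apply, smul_eq_mul, RingHom.id_apply]; ring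

variable [FiniteDimensional ℝ g]

/-- The Levi-Civita product `(u, v) ↦ uv` on `g`: the vector `uv` is determined by the Koszul
formula `2⟨uv,w⟩ = ⟨[u,v],w⟩ + ⟨[w,u],v⟩ + ⟨[w,v],u⟩` for all `w`. -/
def prod (m : LieMetric g) : g →ₗ[ℝ] g →ₗ[ℝ] g :=
  LinearMap.mk₂ ℝ (fun u v => (m.form.toDual m.nondegenerate).symm (m.koszul u v))
    (fun u u' v => by
      rw [← map_add]; congr 1; ext w
      simp only [koszul, add_lie, lie_add, map_add, LinearMap.add_apply, LinearMap.coe_mk,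
        AddHom.coe_mk]
      ring)
    (fun c u v => by
      rw [← map_smul]; congr 1; ext w
      simp only [koszul, smul_lie, lie_smul, map_smul, LinearMap.smul_apply, smul_eq_mul,
        LinearMap.coe_mk, AddHom.coe_mk]
      ring)
    (fun u v v' => by
      rw [← map_add]; congr 1; ext w
      simp only [koszul, lie_add, map_add, LinearMap.add_apply, LinearMap.coe_mk, AddHom.coe_mk]
      ring)
    (fun c u v => by
      rw [← map_smul]; congr 1; ext w
      simp only [koszul, lie_smul, map_smul, LinearMap.smul_apply, smul_eq_mul,
        LinearMap.coe_mk, AddHom.coe_mk]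
      ring)

/-- The Koszul formula for the Levi-Civita product. -/
theorem two_mul_form_prod (m : LieMetric g) (u v w : g) :
    2 * m.form (m.prod u v) w = m.form ⁅u, v⁆ w + m.form ⁅w, u⁆ v + m.form ⁅w, v⁆ u := by
  simp only [prod, LinearMap.mk₂_apply, LinearMap.BilinForm.apply_toDual_symm_apply]
  simp only [koszul, LinearMap.coe_mk, AddHom.coe_mk]
  ring

/-- Left multiplication `L_u v = uv`. -/
def L (m : LieMetric g) (u : g) : Module.End ℝ g := m.prod u

/-- Right multiplication `R_u v = vu`. -/
def R (m : LieMetric g) (u : g) : Module.End ℝ g := m.prod.flip u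

/-- The curvature `K(u,v) = L_{[u,v]} - [L_u, L_v]`. -/
def curvature (m : LieMetric g) (u v : g) : Module.End ℝ g :=
  m.L ⁅u, v⁆ - ⁅m.L u, m.L v⁆

/-- The pseudo-Riemannian Lie algebra `(g, m)` is flat. -/
def IsFlat (m : LieMetric g) : Prop :=
  ∀ u v : g, m.curvature u v = 0

end Lie

section DoubleExtension

variable {B : Type*} [LieRing B] [LieAlgebra ℝ B]

/-- The quadruple `(ξ, D, μ, b₀)` is admissible for the pseudo-Riemannian Lie algebra `(B, m₀)`. -/
structure IsAdmissible [FiniteDimensional ℝ B] (m₀ : LieMetric B) (ξ D : Module.End ℝ B)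
    (μ : ℝ) (b₀ : B) : Prop where
  /-- `ξ` is a 1-cocycle for the representation `L` of `B` on `B`. -/
  cocycle : ∀ a b : B, ξ ⁅a, b⁆ = m₀.L a (ξ b) - m₀.L b (ξ a)
  /-- `D` is a derivation. -/
  derivation : ∀ a b : B, D ⁅a, b⁆ = ⁅D a, b⁆ + ⁅a, D b⁆
  skew : m₀.IsSkew (D - ξ)
  commutator : ⁅D, ξ⁆ = ξ ^ 2 - μ • ξ - m₀.R b₀
  compat : ∀ a b : B, m₀.prod a (ξ b) - ξ (m₀.prod a b) =
    m₀.prod (D a) b + m₀.prod a (D b) - D (m₀.prod a b)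

/-- The inner product on `ℝ z ⊕ B ⊕ ℝ z̄`, where `(s, a, t)` stands for `s z + a + t z̄`: it extends
the one of `B`, `B` is orthogonal to `z` and `z̄`, and `⟨z,z⟩ = ⟨z̄,z̄⟩ = 0`, `⟨z,z̄⟩ = 1`. -/
def doubleExtForm (m₀ : LieMetric B) (x y : ℝ × B × ℝ) : ℝ :=
  x.1 * y.2.2 + x.2.2 * y.1 + m₀.form x.2.1 y.2.1

/-- The bracket on `ℝ z ⊕ B ⊕ ℝ z̄`, where `(s, a, t)` stands for `s z + a + t z̄`: the
skew-symmetric bilinear map with `[z̄,z] = μ z`, `[z̄,a] = D a - ⟨b₀,a⟩ z`,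
`[a,b] = [a,b]_B + ⟨(ξ - ξ*) a, b⟩ z`. Here `⟨(ξ - ξ*) a, b⟩ = ⟨ξ a, b⟩ - ⟨a, ξ b⟩` by the
definition of the adjoint. -/
def doubleExtBracket (m₀ : LieMetric B) (ξ D : Module.End ℝ B) (μ : ℝ) (b₀ : B)
    (x y : ℝ × B × ℝ) : ℝ × B × ℝ :=
  ( μ * (x.2.2 * y.1 - y.2.2 * x.1)
      - x.2.2 * m₀.form b₀ y.2.1 + y.2.2 * m₀.form b₀ x.2.1
      + (m₀.form (ξ x.2.1) y.2.1 - m₀.form x.2.1 (ξ y.2.1)),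
    x.2.2 • D y.2.1 - y.2.2 • D x.2.1 + ⁅x.2.1, y.2.1⁆,
    0 )

/-- The pseudo-Riemannian Lie algebra `(g, m)` is (isometrically isomorphic to) the double extension
of `(B, m₀)` according to `(ξ, D, μ, b₀)`. -/
def IsDoubleExtension {g : Type*} [LieRing g] [LieAlgebra ℝ g] (m : LieMetric g)
    (m₀ : LieMetric B) (ξ D : Module.End ℝ B) (μ : ℝ) (b₀ : B) : Prop :=
  ∃ e : g ≃ₗ[ℝ] ℝ × B × ℝ,
    (∀ u v : g, e ⁅u, v⁆ = doubleExtBracket m₀ ξ D μ b₀ (e u) (e v)) ∧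
    (∀ u v : g, m.form u v = doubleExtForm m₀ (e u) (e v))

end DoubleExtension

section Completeness

/-- Let `G` be a Lie group and `m` a metric on its Lie algebra `T₁G`, that is, a left-invariant
pseudo-Riemannian metric on `G`. A curve `γ : ℝ → G` with velocity `γ'(t) = (dL_{γ(t)})(x(t))`,
`x(t) ∈ T₁G`, is a geodesic (defined for all times) if the covariant derivative `∇_{γ'} γ'`
vanishes. The Levi-Civita connection is left-invariant and given on left-invariant fields by the
Levi-Civita product, so in the left-invariant frame `∇_{γ'} γ'` is
`(dL_{γ(t)}) (x'(t) + x(t)x(t))`. -/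
def IsGeodesicWith {n : ℕ} {G : Type*} [TopologicalSpace G]
    [ChartedSpace (EuclideanSpace ℝ (Fin n)) G] [Group G] [LieGroup (𝓡 n) ∞ G]
    (m : LieMetric (GroupLieAlgebra (𝓡 n) G)) (γ : ℝ → G)
    (x : ℝ → GroupLieAlgebra (𝓡 n) G) : Prop :=
  (∀ t : ℝ, HasMFDerivAt 𝓘(ℝ, ℝ) (𝓡 n) γ t
    (ContinuousLinearMap.smulRight (1 : ℝ →L[ℝ] ℝ) (mulInvariantVectorField (x t) (γ t)))) ∧
  (∀ t : ℝ, HasDerivAt x (-(m.prod (x t) (x t))) t)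

/-- The left-invariant metric on the Lie group `G` determined by `m` is geodesically complete: every
tangent vector `(dL_p)(v)`, `p ∈ G`, `v ∈ T₁G`, is the initial velocity of a geodesic which is
defined on all of `ℝ`. -/
def IsGeodesicallyComplete {n : ℕ} {G : Type*} [TopologicalSpace G]
    [ChartedSpace (EuclideanSpace ℝ (Fin n)) G] [Group G] [LieGroup (𝓡 n) ∞ G]
    (m : LieMetric (GroupLieAlgebra (𝓡 n) G)) : Prop :=
  ∀ (p : G) (v : GroupLieAlgebra (𝓡 n) G),
    ∃ (γ : ℝ → G) (x : ℝ → GroupLieAlgebra (𝓡 n) G), γ 0 = p ∧ x 0 = v ∧ m.IsGeodesicWith γ x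

/-- The pseudo-Riemannian Lie algebra `(g, m)` is complete: the left-invariant metric is
geodesically complete on every Lie group with a left-invariant metric whose Lie algebra is
isometrically isomorphic to `(g, m)`. -/
def IsComplete {g : Type u} [LieRing g] [LieAlgebra ℝ g] (m : LieMetric g) : Prop :=
  ∀ (n : ℕ) (G : Type v) [TopologicalSpace G] [T2Space G]
    [ChartedSpace (EuclideanSpace ℝ (Fin n)) G] [Group G] [LieGroup (𝓡 n) ∞ G]
    (m' : LieMetric (GroupLieAlgebra (𝓡 n) G)) (φ : GroupLieAlgebra (𝓡 n) G ≃ₗ⁅ℝ⁆ g),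
    (∀ u w, m.form (φ u) (φ w) = m'.form u w) → m'.IsGeodesicallyComplete

end Completeness

end LieMetric

/-- A finite-dimensional real Lie algebra is unimodular: `tr (ad u) = 0` for all `u`. -/
def IsUnimodularLieAlgebra (g : Type*) [LieRing g] [LieAlgebra ℝ g] : Prop :=
  ∀ u : g, LinearMap.trace ℝ g (LieAlgebra.ad ℝ g u) = 0

end

/-!
A degenerate center contains a nonzero null vector `z` orthogonal to the whole center. In a flat
Lorentzian Lie algebra such a `z` satisfies `L_z = R_z = 0`
(`LieMetric.IsFlat.prod_eq_zero_of_null_central`): flatness gives `L_z ^ 2 = 0`, so the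
skew-symmetric map `L_z` has a totally null image, at most a line in Lorentzian signature, and a
skew-symmetric map of rank at most one vanishes. Choosing a null vector `z̄` with `⟨z, z̄⟩ = 1`, the
space splits as `ℝ z ⊕ B ⊕ ℝ z̄` with `B` Euclidean, and reading off the brackets in this splitting
gives the data `ξ`, `D`, `b₀` with `μ = 0`. The Levi-Civita product of such a double extension is
explicit (`LieMetric.doubleExtProd`), and expanding its curvature shows that flatness is equivalent
to flatness of `B` together with the equations of admissibility
(`LieMetric.isFlat_iff_of_doubleExt`). Finally `(D, b₀) ≠ (0, 0)`, since otherwise `z̄` would be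
central and not orthogonal to `z`.

Unimodularity: on a flat Riemannian Lie algebra all right multiplications have trace zero
(`LieMetric.IsFlat.trace_R_eq_zero`). Together with the cocycle and commutator equations this yields
`tr (ξ ^ (k + 2)) = tr (ξ ^ k R_{b₀}) = 0` for all `k`. Hence `ξ` is nilpotent, and
`tr D = tr ξ = 0` because `D - ξ` is skew-symmetric.

Completeness: the geodesic equation on a Lie group separates into the Euler equation
`x' = -(x x)` on the Lie algebra and the reconstruction `γ' = dL_γ x`. On a double extension with
Riemannian `B` the `z̄`-coordinate of `x` is constant. The `B`-coordinate `a` satisfies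
`|⟨a, a'⟩| ≤ C (1 + ‖a‖²)`, because the quadratic term `a a` is orthogonal to `a`; so it stays
bounded in finite time (`exists_forall_hasDerivAt_euler`). The `z`-coordinate is then an integral.
The reconstruction equation is a time-dependent left-invariant equation, solvable for all times
because left translates of a local solution through the identity continue every solution
(`exists_forall_hasMFDerivAt_mulInvariantVectorField`).
-/

noncomputable section

/-! ### The Levi-Civita product -/

namespace LieMetric

section LinearAlgebra

variable {V : Type*} [AddCommGroup V] [Module ℝ V] (m : LieMetric V)

theorem form_comm (u v : V) : m.form u v = m.form v u :=
  m.symm.eq u v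

theorem ext_form {u v : V} (h : ∀ w, m.form u w = m.form v w) : u = v := by
  rw [← sub_eq_zero]
  exact m.nondegenerate.1 _ fun w => by simp [h w]

variable [FiniteDimensional ℝ V]

theorem trace_eq_zero_of_isSkew {A : Module.End ℝ V} (hA : m.IsSkew A) :
    LinearMap.trace ℝ V A = 0 := by
  -- The isomorphism with the dual intertwines `A` and the negative of its transpose.
  have h : (m.form.toDual m.nondegenerate).conj A =
      (-1 : ℝ) • Module.Dual.transpose (R := ℝ) A := by
    ext φ v
    obtain ⟨u, rfl⟩ := (m.form.toDual m.nondegenerate).surjective φ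
    simp [LinearEquiv.conj_apply, LinearMap.BilinForm.toDual_def, hA u v,
      Module.Dual.transpose_apply]
  have h2 := LinearMap.trace_conj' A (m.form.toDual m.nondegenerate)
  rw [h, map_smul, LinearMap.trace_transpose', smul_eq_mul] at h2
  linarith

/-- A Riemannian metric as an inner product in Mathlib's sense. -/
abbrev IsRiemannian.core {m : LieMetric V} (hm : m.IsRiemannian) : InnerProductSpace.Core ℝ V where
  inner u v := m.form u v
  conj_inner_symm u v := m.form_comm v u
  re_inner_nonneg u := by
    by_cases h : u = 0
    · simp [h]
    · exact (hm u h).le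
  add_left u v w := by simp
  smul_left u v r := by simp
  definite u h := by
    by_contra h0
    exact (hm u h0).ne' h

end LinearAlgebra

section Lie

variable {g : Type*} [LieRing g] [LieAlgebra ℝ g] [FiniteDimensional ℝ g] (m : LieMetric g)

/-- The Koszul formula characterizes the Levi-Civita product. -/
theorem prod_eq_of_koszul {u v p : g}
    (h : ∀ w, 2 * m.form p w = m.form ⁅u, v⁆ w + m.form ⁅w, u⁆ v + m.form ⁅w, v⁆ u) :
    m.prod u v = p :=
  m.ext_form fun w => by linarith [h w, m.two_mul_form_prod u v w]

theorem form_prod_left (u v w : g) : m.form (m.prod u v) w = -m.form v (m.prod u w) := by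
  have h1 := m.two_mul_form_prod u v w
  have h2 := m.two_mul_form_prod u w v
  rw [← lie_skew v w, ← lie_skew v u, ← lie_skew w u] at *
  simp only [map_neg, LinearMap.neg_apply] at *
  rw [m.form_comm v]
  linarith

theorem prod_sub_prod (u v : g) : m.prod u v - m.prod v u = ⁅u, v⁆ :=
  m.ext_form fun w => by
    have h1 := m.two_mul_form_prod u v w
    have h2 := m.two_mul_form_prod v u w
    rw [← lie_skew v u] at h2
    simp only [map_neg, map_sub, LinearMap.sub_apply, LinearMap.neg_apply] at *
    linarith

@[simp] theorem R_apply (u v : g) : m.R u v = m.prod v u := rfl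

@[simp] theorem L_apply (u v : g) : m.L u v = m.prod u v := rfl

theorem isFlat_iff : m.IsFlat ↔ ∀ u v w : g,
    m.prod ⁅u, v⁆ w = m.prod u (m.prod v w) - m.prod v (m.prod u w) := by
  refine forall₂_congr fun u v => ?_
  rw [LinearMap.ext_iff]
  refine forall_congr' fun w => ?_
  simp [curvature, Ring.lie_def, sub_eq_zero]

theorem trace_ad (u : g) :
    LinearMap.trace ℝ g (LieAlgebra.ad ℝ g u) = -LinearMap.trace ℝ g (m.R u) := by
  have h : LieAlgebra.ad ℝ g u = m.L u - m.R u := by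
    ext v
    simp [m.prod_sub_prod]
  rw [h, map_sub, m.trace_eq_zero_of_isSkew (A := m.L u) (m.form_prod_left u), zero_sub]

end Lie

end LieMetric

/-! ### Flat Riemannian Lie algebras are unimodular -/

theorem LinearMap.IsSymmetric.eq_zero_of_trace_mul_self_eq_zero {E : Type*} [NormedAddCommGroup E]
    [InnerProductSpace ℝ E] [FiniteDimensional ℝ E] {P : Module.End ℝ E} (hP : P.IsSymmetric)
    (h : LinearMap.trace ℝ E (P * P) = 0) : P = 0 := by
  set b := stdOrthonormalBasis ℝ E
  rw [LinearMap.trace_eq_sum_inner _ b] at h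
  have h' : ∀ i, inner ℝ (b i) ((P * P) (b i)) = ‖P (b i)‖ ^ 2 := fun i => by
    rw [Module.End.mul_apply, ← hP, real_inner_self_eq_norm_sq]
  simp only [h'] at h
  rw [Finset.sum_eq_zero_iff_of_nonneg fun i _ => sq_nonneg _] at h
  refine b.toBasis.ext fun i => ?_
  simpa using h i (Finset.mem_univ i)

namespace LieMetric

variable {B : Type*} [LieRing B] [LieAlgebra ℝ B] [FiniteDimensional ℝ B]

/-- The left symmetry of a flat Levi-Civita product, written for right multiplications. -/
theorem IsFlat.lie_L_R {m : LieMetric B} (hf : m.IsFlat) (u v : B) :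
    m.L u * m.R v - m.R v * m.L u = m.R (m.prod u v) - m.R v * m.R u := by
  ext w
  have h := m.isFlat_iff.1 hf u w v
  rw [← m.prod_sub_prod] at h
  simp only [map_sub, LinearMap.sub_apply] at h
  simp only [LinearMap.sub_apply, Module.End.mul_apply, L_apply, R_apply]
  linear_combination (norm := module) (-1 : ℝ) • h

theorem IsFlat.trace_R_prod {m : LieMetric B} (hf : m.IsFlat) (u v : B) :
    LinearMap.trace ℝ B (m.R (m.prod u v)) = LinearMap.trace ℝ B (m.R v * m.R u) := by
  have h := congrArg (LinearMap.trace ℝ B) (hf.lie_L_R u v)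
  rw [map_sub, map_sub, LinearMap.trace_mul_comm, sub_self] at h
  linarith

/-- If `h` represents the linear form `u ↦ tr R_u`, then `R_h` is symmetric and
`tr (R_h ^ 2) = tr R_{hh} = ⟨h, hh⟩ = 0`, so `R_h = 0` and `⟨h, h⟩ = tr R_h = 0`. -/
theorem IsFlat.trace_R_eq_zero {m : LieMetric B} (hf : m.IsFlat) (hm : m.IsRiemannian) (b : B) :
    LinearMap.trace ℝ B (m.R b) = 0 := by
  set h : B := (m.form.toDual m.nondegenerate).symm (LinearMap.trace ℝ B ∘ₗ m.prod.flip) with hh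
  have key : ∀ u, m.form h u = LinearMap.trace ℝ B (m.R u) := fun u => by
    rw [hh, LinearMap.BilinForm.apply_toDual_symm_apply]; rfl
  have hsymm : ∀ u v, m.form (m.R h u) v = m.form u (m.R h v) := fun u v => by
    have h1 := m.form_prod_left u h v
    have h2 := m.form_prod_left v h u
    rw [key, hf.trace_R_prod] at h1 h2
    rw [R_apply, R_apply, m.form_comm u, h1, h2, LinearMap.trace_mul_comm]
  have htr : LinearMap.trace ℝ B (m.R h * m.R h) = 0 := by
    have h1 := m.form_prod_left h h h
    rw [m.form_comm] at h1
    rw [← hf.trace_R_prod, ← key]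
    linarith
  have hR : m.R h = 0 := by
    let _ := hm.core.toNormedAddCommGroup
    let _ := InnerProductSpace.ofCore hm.core.toCore
    exact LinearMap.IsSymmetric.eq_zero_of_trace_mul_self_eq_zero (P := m.R h) hsymm htr
  have h0 : h = 0 := by
    by_contra hne
    have := hm h hne
    rw [key, hR, map_zero] at this
    exact lt_irrefl _ this
  rw [← key, h0, map_zero, LinearMap.zero_apply]

end LieMetric

/-- A power `f ^ k` with `k` large has a polynomial multiple that is the projection onto the
nonsingular part of `f` along its nilpotent part; its trace, the rank, vanishes. -/
theorem Module.End.isNilpotent_of_trace_pow_eq_zero {K V : Type*} [Field K] [CharZero K]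
    [AddCommGroup V] [Module K V] [FiniteDimensional K V] (f : Module.End K V)
    (h : ∀ k : ℕ, LinearMap.trace K V (f ^ (k + 2)) = 0) : IsNilpotent f := by
  open Polynomial in
  obtain ⟨q, hq, hX⟩ := exists_eq_pow_rootMultiplicity_mul_and_not_dvd (minpoly K f)
    (minpoly.ne_zero (Algebra.IsIntegral.isIntegral f)) 0
  rw [C_0, sub_zero] at hq hX
  set n := rootMultiplicity 0 (minpoly K f)
  have hcop : IsCoprime (X ^ (n + 2)) q := by
    refine IsCoprime.pow_left ?_
    exact (Polynomial.prime_X.irreducible.coprime_iff_not_dvd).2 hX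
  obtain ⟨a, b, hab⟩ := hcop
  set e := aeval f (a * X ^ (n + 2)) with he
  have hzero : e * aeval f (b * q) = 0 := by
    rw [he, ← map_mul, show a * X ^ (n + 2) * (b * q) = (a * b * X ^ 2) * (X ^ n * q) by ring, ← hq,
      map_mul, minpoly.aeval, mul_zero]
  have hone : e + aeval f (b * q) = 1 := by rw [he, ← map_add, hab, map_one]
  have hidem : IsIdempotentElem e := by
    have := congrArg (e * ·) hone
    simp only [mul_add, hzero, add_zero, mul_one] at this
    exact this
  have htr : LinearMap.trace K V e = 0 := by
    rw [he, map_mul, map_pow, aeval_X, aeval_eq_sum_range, Finset.sum_mul, map_sum]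
    refine Finset.sum_eq_zero fun i _ => ?_
    rw [smul_mul_assoc, map_smul, ← pow_add, ← add_assoc, h, smul_zero]
  have he0 : e = 0 := (LinearMap.IsIdempotentElem.trace_eq_zero_iff hidem).1 htr
  refine ⟨n, ?_⟩
  have h1 : aeval f (b * q) = 1 := by rw [← hone, he0, zero_add]
  calc f ^ n = f ^ n * aeval f (b * q) := by rw [h1, mul_one]
    _ = aeval f (b * (X ^ n * q)) := by
      rw [show b * (X ^ n * q) = X ^ n * (b * q) by ring, map_mul _ (X ^ n), map_pow,
        aeval_X]
    _ = 0 := by rw [← hq, map_mul, minpoly.aeval, mul_zero]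

/-! ### The Levi-Civita product of a double extension -/

namespace LieMetric

/-- The Levi-Civita product on `ℝ z ⊕ B ⊕ ℝ z̄` for the parameter `μ = 0`: `z` annihilates
everything on both sides, `ab = a·b + ⟨ξ a, b⟩ z`, `a z̄ = -ξ a`, `z̄ a = (D - ξ) a - ⟨b₀, a⟩ z` and
`z̄ z̄ = b₀`. -/
def doubleExtProd {B : Type*} [LieRing B] [LieAlgebra ℝ B] [FiniteDimensional ℝ B]
    (m₀ : LieMetric B) (ξ D : Module.End ℝ B) (b₀ : B) (x y : ℝ × B × ℝ) : ℝ × B × ℝ :=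
  ( m₀.form (ξ x.2.1) y.2.1 - x.2.2 * m₀.form b₀ y.2.1,
    m₀.prod x.2.1 y.2.1 + x.2.2 • (D y.2.1 - ξ y.2.1) - y.2.2 • ξ x.2.1 + (x.2.2 * y.2.2) • b₀,
    0 )

section

variable {g : Type*} [LieRing g] [LieAlgebra ℝ g] [FiniteDimensional ℝ g] {m : LieMetric g}
  {B : Type*} [LieRing B] [LieAlgebra ℝ B] [FiniteDimensional ℝ B] {m₀ : LieMetric B}
  {ξ D : Module.End ℝ B} {b₀ : B} {e : g ≃ₗ[ℝ] ℝ × B × ℝ}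

theorem apply_prod_eq_doubleExtProd (hskew : m₀.IsSkew (D - ξ))
    (he : ∀ u v : g, e ⁅u, v⁆ = doubleExtBracket m₀ ξ D 0 b₀ (e u) (e v))
    (hm : ∀ u v : g, m.form u v = doubleExtForm m₀ (e u) (e v)) (u v : g) :
    e (m.prod u v) = doubleExtProd m₀ ξ D b₀ (e u) (e v) := by
  rw [← e.eq_symm_apply]
  refine m.prod_eq_of_koszul fun w => ?_
  simp only [hm, he, e.apply_symm_apply]
  obtain ⟨s, a, t⟩ := e u
  obtain ⟨s', a', t'⟩ := e v
  obtain ⟨s'', c, t''⟩ := e w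
  have h0 := m₀.two_mul_form_prod a a' c
  have h1 := hskew a' c
  have h2 := hskew a c
  have h3 := hskew a a'
  simp only [LinearMap.sub_apply, map_sub] at h1 h2 h3
  simp only [doubleExtForm, doubleExtBracket, doubleExtProd, map_add, map_sub, map_smul,
    LinearMap.add_apply, LinearMap.sub_apply, LinearMap.smul_apply, smul_eq_mul]
  rw [m₀.form_comm (D c) a', m₀.form_comm (ξ c) a, m₀.form_comm c (ξ a), m₀.form_comm (D c) a,
    m₀.form_comm (D a') a, m₀.form_comm (ξ c) a', m₀.form_comm c (ξ a')]
  linear_combination h0 + t * h1 + t' * h2 - t'' * h3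

/-- For `D - ξ` skew-symmetric, the curvature of a double extension with `μ = 0` vanishes exactly
when that of `B` does and the remaining equations of admissibility, other than the derivation
property, hold. -/
theorem isFlat_iff_of_doubleExt (hskew : m₀.IsSkew (D - ξ))
    (he : ∀ u v : g, e ⁅u, v⁆ = doubleExtBracket m₀ ξ D 0 b₀ (e u) (e v))
    (hm : ∀ u v : g, m.form u v = doubleExtForm m₀ (e u) (e v)) :
    m.IsFlat ↔ m₀.IsFlat ∧ (∀ a b : B, ξ ⁅a, b⁆ = m₀.L a (ξ b) - m₀.L b (ξ a)) ∧
      (∀ a : B, D (ξ a) - ξ (D a) = ξ (ξ a) - m₀.prod a b₀) ∧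
      (∀ a b : B, m₀.prod a (ξ b) - ξ (m₀.prod a b) =
        m₀.prod (D a) b + m₀.prod a (D b) - D (m₀.prod a b)) := by
  have hflat : m.IsFlat ↔ ∀ x y w : ℝ × B × ℝ,
      doubleExtProd m₀ ξ D b₀ (doubleExtBracket m₀ ξ D 0 b₀ x y) w =
        doubleExtProd m₀ ξ D b₀ x (doubleExtProd m₀ ξ D b₀ y w) -
        doubleExtProd m₀ ξ D b₀ y (doubleExtProd m₀ ξ D b₀ x w) := by
    rw [isFlat_iff, e.symm.surjective.forall₃]
    refine forall₃_congr fun x y w => ?_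
    rw [← e.injective.eq_iff]
    simp only [map_sub, apply_prod_eq_doubleExtProd hskew he hm, he, LinearEquiv.apply_symm_apply]
  rw [hflat]
  constructor
  · intro h
    refine ⟨m₀.isFlat_iff.2 fun a b c => ?_, fun a b => ?_, fun a => ?_, fun a b => ?_⟩
    · have := congrArg (fun p => p.2.1) (h (0, a, 0) (0, b, 0) (0, c, 0))
      simpa [doubleExtProd, doubleExtBracket] using this
    · have := congrArg (fun p => p.2.1) (h (0, a, 0) (0, b, 0) (0, 0, 1))
      simp [doubleExtProd, doubleExtBracket] at this
      simp only [L_apply]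
      linear_combination (norm := module) (-1 : ℝ) • this
    · have := congrArg (fun p => p.2.1) (h (0, 0, 1) (0, a, 0) (0, 0, 1))
      simp [doubleExtProd, doubleExtBracket] at this
      linear_combination (norm := module) this
    · have := congrArg (fun p => p.2.1) (h (0, 0, 1) (0, a, 0) (0, b, 0))
      simp [doubleExtProd, doubleExtBracket] at this
      linear_combination (norm := module) (-1 : ℝ) • this
  · rintro ⟨hf, hcoc, hcomm, hcompat⟩ ⟨s, a, t⟩ ⟨s', b, t'⟩ ⟨s'', c, r⟩
    have hf' := m₀.isFlat_iff.1 hf a b c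
    have hcoc' := hcoc a b
    simp only [L_apply] at hcoc'
    refine Prod.ext ?_ (Prod.ext ?_ ?_)
    · have h1 := congrArg (fun x => m₀.form x c) hcoc'
      have h2 := congrArg (fun x => m₀.form x c) (hcomm a)
      have h3 := congrArg (fun x => m₀.form x c) (hcomm b)
      have k1 := m₀.form_prod_left a (ξ b) c
      have k2 := m₀.form_prod_left b (ξ a) c
      have k3 := m₀.form_prod_left a b₀ c
      have k4 := m₀.form_prod_left b b₀ c
      have k5 := hskew (ξ a) c
      have k6 := hskew (ξ b) c
      simp only [map_sub, LinearMap.sub_apply] at h1 h2 h3 k5 k6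
      simp only [doubleExtProd, doubleExtBracket, map_add, map_sub, map_smul,
        LinearMap.add_apply, LinearMap.sub_apply, LinearMap.smul_apply, smul_eq_mul, Prod.fst_sub]
      rw [m₀.form_comm b₀ (ξ a), m₀.form_comm b₀ (ξ b), m₀.form_comm (ξ b) (ξ a)]
      linear_combination h1 + k1 - k2 + t' * h2 - t' * k5 - t' * k3 - t * h3 + t * k6 + t * k4
    · have h2 := hcomm a
      have h3 := hcomm b
      have h4 := hcompat a c
      have h5 := hcompat b c
      simp only [doubleExtProd, doubleExtBracket, map_add, map_sub, map_smul,
        LinearMap.add_apply, LinearMap.sub_apply, LinearMap.smul_apply, Prod.fst_sub, Prod.snd_sub]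
      linear_combination (norm := module) hf' - r • hcoc' + (t * r) • h3 - (t' * r) • h2 - t • h5 +
        t' • h4
    · simp [doubleExtProd, doubleExtBracket]

end

theorem derivation_of_doubleExt {g : Type*} [LieRing g] [LieAlgebra ℝ g]
    {B : Type*} [LieRing B] [LieAlgebra ℝ B] {m₀ : LieMetric B} {ξ D : Module.End ℝ B} {b₀ : B}
    {e : g ≃ₗ[ℝ] ℝ × B × ℝ}
    (he : ∀ u v : g, e ⁅u, v⁆ = doubleExtBracket m₀ ξ D 0 b₀ (e u) (e v)) (a b : B) :
    D ⁅a, b⁆ = ⁅D a, b⁆ + ⁅a, D b⁆ := by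
  have h := congrArg (fun u => (e u).2.1)
    (leibniz_lie (e.symm (0, 0, 1)) (e.symm (0, a, 0)) (e.symm (0, b, 0)))
  simp only [map_add, he, doubleExtBracket, LinearEquiv.apply_symm_apply, Prod.snd_add,
    Prod.fst_add] at h
  simpa using h

/-! ### Flat double extensions are unimodular -/

section

variable {B : Type*} [LieRing B] [LieAlgebra ℝ B] [FiniteDimensional ℝ B] {m₀ : LieMetric B}
  {ξ D : Module.End ℝ B} {b₀ : B}

/-- The cocycle and compatibility conditions combine to `[L_a, ξ] = R_{ξ a} - ξ R_a`. -/
theorem IsAdmissible.lie_L_left {μ : ℝ} (h : m₀.IsAdmissible ξ D μ b₀) (a : B) :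
    m₀.L a * ξ - ξ * m₀.L a = m₀.R (ξ a) - ξ * m₀.R a := by
  ext b
  have h1 := h.cocycle a b
  rw [← m₀.prod_sub_prod] at h1
  simp only [map_sub, L_apply] at h1
  simp only [LinearMap.sub_apply, Module.End.mul_apply, L_apply, R_apply]
  linear_combination (norm := module) (-1 : ℝ) • h1

/-- `tr (ξ ^ k R_a) = tr R_{ξ ^ k a}`, and right multiplications of `B` have trace zero. -/
theorem IsAdmissible.trace_pow_mul_R {μ : ℝ} (h : m₀.IsAdmissible ξ D μ b₀) (hf : m₀.IsFlat)
    (hR : m₀.IsRiemannian) (k : ℕ) (a : B) : LinearMap.trace ℝ B (ξ ^ k * m₀.R a) = 0 := by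
  induction k generalizing a with
  | zero => simpa using hf.trace_R_eq_zero hR a
  | succ k ih =>
    have h1 := congrArg (fun f => LinearMap.trace ℝ B (ξ ^ k * f)) (h.lie_L_left a)
    simp only [mul_sub, map_sub, ih, ← mul_assoc, ← pow_succ] at h1
    rw [mul_assoc, LinearMap.trace_mul_comm, mul_assoc, ← pow_succ', LinearMap.trace_mul_comm,
      sub_self] at h1
    linarith

/-- The commutator equation gives `tr (ξ ^ (k + 2)) = tr (ξ ^ k R_{b₀}) = 0` for all `k`. -/
theorem IsAdmissible.isNilpotent (h : m₀.IsAdmissible ξ D 0 b₀) (hf : m₀.IsFlat)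
    (hR : m₀.IsRiemannian) : IsNilpotent ξ := by
  refine Module.End.isNilpotent_of_trace_pow_eq_zero ξ fun k => ?_
  have h1 := congrArg (fun f => LinearMap.trace ℝ B (ξ ^ k * f)) h.commutator
  simp only [Ring.lie_def, zero_smul, sub_zero, mul_sub, map_sub, h.trace_pow_mul_R hf hR,
    ← pow_add, ← mul_assoc, ← pow_succ] at h1
  rw [← h1, LinearMap.trace_mul_comm, ← mul_assoc, ← pow_succ', sub_self]

theorem IsAdmissible.trace_eq_zero (h : m₀.IsAdmissible ξ D 0 b₀) (hf : m₀.IsFlat)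
    (hR : m₀.IsRiemannian) : LinearMap.trace ℝ B D = 0 := by
  have h1 := m₀.trace_eq_zero_of_isSkew h.skew
  rwa [map_sub, (LinearMap.isNilpotent_trace_of_isNilpotent (h.isNilpotent hf hR)).eq_zero,
    sub_zero] at h1

end

theorem _root_.LinearMap.trace_eq_trace_fst_add_trace_snd {R M N : Type*} [CommRing R]
    [AddCommGroup M] [AddCommGroup N] [Module R M] [Module R N] [Module.Free R M]
    [Module.Finite R M] [Module.Free R N] [Module.Finite R N] (T : M × N →ₗ[R] M × N) :
    LinearMap.trace R (M × N) T =
      LinearMap.trace R M (LinearMap.fst R M N ∘ₗ T ∘ₗ LinearMap.inl R M N) +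
      LinearMap.trace R N (LinearMap.snd R M N ∘ₗ T ∘ₗ LinearMap.inr R M N) := by
  rw [LinearMap.trace_comp_comm' (T ∘ₗ LinearMap.inl R M N),
    LinearMap.trace_comp_comm' (T ∘ₗ LinearMap.inr R M N), ← map_add]
  congr 1
  ext x <;> simp [Prod.mk_zero_zero]

/-- `ad_u` preserves the flag `ℝ z ⊆ ℝ z ⊕ B`; of its diagonal blocks only `t D + ad_a` on `B` is
nonzero, and its trace vanishes. -/
theorem IsDoubleExtension.isUnimodular {g : Type*} [LieRing g] [LieAlgebra ℝ g]
    [FiniteDimensional ℝ g] {m : LieMetric g}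
    {B : Type*} [LieRing B] [LieAlgebra ℝ B] [FiniteDimensional ℝ B] {m₀ : LieMetric B}
    {ξ D : Module.End ℝ B} {b₀ : B} (hd : m.IsDoubleExtension m₀ ξ D 0 b₀)
    (h : m₀.IsAdmissible ξ D 0 b₀) (hf : m₀.IsFlat) (hR : m₀.IsRiemannian) :
    IsUnimodularLieAlgebra g := by
  obtain ⟨e, he, -⟩ := hd
  intro u
  rw [← LinearMap.trace_conj' _ e, LinearMap.trace_eq_trace_fst_add_trace_snd,
    LinearMap.trace_eq_trace_fst_add_trace_snd]
  obtain ⟨⟨s, a, t⟩, rfl⟩ := e.symm.surjective u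
  have h1 : LinearMap.fst ℝ ℝ (B × ℝ) ∘ₗ e.conj (LieAlgebra.ad ℝ g (e.symm (s, a, t))) ∘ₗ
      LinearMap.inl ℝ ℝ (B × ℝ) = 0 := by
    ext
    simp [LinearEquiv.conj_apply, he, doubleExtBracket]
  have h2 : LinearMap.fst ℝ B ℝ ∘ₗ (LinearMap.snd ℝ ℝ (B × ℝ) ∘ₗ
      e.conj (LieAlgebra.ad ℝ g (e.symm (s, a, t))) ∘ₗ LinearMap.inr ℝ ℝ (B × ℝ)) ∘ₗ
      LinearMap.inl ℝ B ℝ = t • D + LieAlgebra.ad ℝ B a := by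
    ext
    simp [LinearEquiv.conj_apply, he, doubleExtBracket]
  have h3 : LinearMap.snd ℝ B ℝ ∘ₗ (LinearMap.snd ℝ ℝ (B × ℝ) ∘ₗ
      e.conj (LieAlgebra.ad ℝ g (e.symm (s, a, t))) ∘ₗ LinearMap.inr ℝ ℝ (B × ℝ)) ∘ₗ
      LinearMap.inr ℝ B ℝ = 0 := by
    ext
    simp [LinearEquiv.conj_apply, he, doubleExtBracket]
  rw [h1, h2, h3, map_add, map_smul, h.trace_eq_zero hf hR, m₀.trace_ad, hf.trace_R_eq_zero hR]
  simp

end LieMetric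

/-! ### Lorentzian linear algebra -/

namespace LieMetric

section LinearAlgebra

variable {V : Type*} [AddCommGroup V] [Module ℝ V] {m : LieMetric V}

/-- The orthogonal complement of a null vector `z` is positive semidefinite, with kernel `ℝ z`.
Subtracting a multiple of `z` makes the timelike coordinate vanish without changing the norm. -/
theorem IsLorentzian.form_self_of_orthogonal (hL : m.IsLorentzian) {z u : V} (hz0 : z ≠ 0)
    (hz : m.form z z = 0) (hzu : m.form z u = 0) :
    0 ≤ m.form u u ∧ (m.form u u = 0 → ∃ c : ℝ, u = c • z) := by
  obtain ⟨n, e, he⟩ := hL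
  have hform : ∀ v, m.form v v = -(e.repr v 0) ^ 2 + ∑ i : Fin n, (e.repr v i.succ) ^ 2 := by
    intro v
    have hsum : ∀ c : Fin (n + 1) → ℝ, m.form (∑ i, c i • e i) (∑ i, c i • e i) =
        -(c 0) ^ 2 + ∑ i : Fin n, (c i.succ) ^ 2 := fun c => by
      simp [he, Fin.sum_univ_succ, Fin.succ_ne_zero, (Fin.succ_ne_zero _).symm, sq]
    rw [← hsum, e.sum_repr]
  have hzero : ∀ v, e.repr v 0 = 0 → 0 ≤ m.form v v ∧ (m.form v v = 0 → v = 0) := by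
    intro v hv
    have hnn : ∀ i ∈ Finset.univ, 0 ≤ (e.repr v (Fin.succ i : Fin (n + 1))) ^ 2 :=
      fun i _ => sq_nonneg _
    rw [hform, hv]
    simp only [ne_eq, OfNat.ofNat_ne_zero, not_false_eq_true, zero_pow, neg_zero, zero_add]
    refine ⟨Finset.sum_nonneg hnn, fun h => ?_⟩
    rw [Finset.sum_eq_zero_iff_of_nonneg hnn] at h
    refine e.repr.map_eq_zero_iff.1 (Finsupp.ext fun i => ?_)
    refine Fin.cases hv (fun i => ?_) i
    simpa using h i (Finset.mem_univ i)
  have hz1 : e.repr z 0 ≠ 0 := fun h => hz0 ((hzero z h).2 hz)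
  set c := e.repr u 0 / e.repr z 0
  have hw := hzero (u - c • z) (by simp [c, div_mul_cancel₀ _ hz1])
  have huw : m.form (u - c • z) (u - c • z) = m.form u u := by
    simp [hz, hzu, m.form_comm u z]
  rw [huw, sub_eq_zero] at hw
  exact ⟨hw.1, fun h => ⟨c, hw.2 h⟩⟩

/-- Two null vectors `z` and `z̄` with `⟨z, z̄⟩ = 1`. -/
structure IsHyperbolicPair (m : LieMetric V) (z zb : V) : Prop where
  form_left : m.form z z = 0
  form_right : m.form zb zb = 0
  form_left_right : m.form z zb = 1

theorem exists_isHyperbolicPair {z : V} (hz0 : z ≠ 0) (hz : m.form z z = 0) :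
    ∃ zb, m.IsHyperbolicPair z zb := by
  obtain ⟨y, hy⟩ : ∃ y, m.form z y ≠ 0 := by
    by_contra! h
    exact hz0 (m.nondegenerate.1 z h)
  refine ⟨(m.form z y)⁻¹ • y - ((m.form y y) / (2 * (m.form z y) ^ 2)) • z, hz, ?_, ?_⟩
  · simp only [map_sub, map_smul, LinearMap.sub_apply, LinearMap.smul_apply, smul_eq_mul, hz,
      m.form_comm y z]
    field_simp
    ring
  · simp [hz, hy]

/-- The orthogonal complement of two vectors. -/
def orthogonalPair (m : LieMetric V) (z zb : V) : Submodule ℝ V :=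
  LinearMap.ker (m.form z) ⊓ LinearMap.ker (m.form zb)

theorem form_left_coe {z zb : V} (b : m.orthogonalPair z zb) : m.form z b = 0 := b.2.1

theorem form_right_coe {z zb : V} (b : m.orthogonalPair z zb) : m.form zb b = 0 := b.2.2

namespace IsHyperbolicPair

variable {z zb : V} (h : m.IsHyperbolicPair z zb)
include h

theorem form_right_left : m.form zb z = 1 := by
  rw [m.form_comm, h.form_left_right]

/-- The orthogonal projection onto the orthogonal complement of a hyperbolic pair. -/
def proj : V →ₗ[ℝ] m.orthogonalPair z zb :=
  LinearMap.codRestrict _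
    (LinearMap.id - (m.form zb).smulRight z - (m.form z).smulRight zb) fun u => by
      constructor <;>
      simp [h.form_left, h.form_right, h.form_left_right, h.form_right_left]

theorem coe_proj (u : V) : (h.proj u : V) = u - m.form zb u • z - m.form z u • zb := rfl

theorem form_proj (u : V) (b : m.orthogonalPair z zb) : m.form (h.proj u) b = m.form u b := by
  simp [coe_proj, form_left_coe, form_right_coe]

/-- The decomposition `V = ℝ z ⊕ {z, z̄}ᗮ ⊕ ℝ z̄` given by a hyperbolic pair. -/
def split : V ≃ₗ[ℝ] ℝ × m.orthogonalPair z zb × ℝ where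
  toFun u := (m.form zb u, h.proj u, m.form z u)
  map_add' u v := by simp
  map_smul' c u := by simp
  invFun x := x.1 • z + x.2.1 + x.2.2 • zb
  left_inv u := by
    simp only [coe_proj]
    abel
  right_inv x := by
    obtain ⟨s, a, t⟩ := x
    refine Prod.ext ?_ (Prod.ext (Subtype.ext ?_) ?_)
    · simp [h.form_right_left, h.form_right, form_right_coe]
    · simp [coe_proj, h.form_left, h.form_right, h.form_left_right, h.form_right_left,
        form_left_coe, form_right_coe]
    · simp [h.form_left, h.form_left_right, form_left_coe]

theorem split_apply (u : V) : h.split u = (m.form zb u, h.proj u, m.form z u) := rfl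

theorem split_symm_apply (s : ℝ) (a : m.orthogonalPair z zb) (t : ℝ) :
    h.split.symm (s, a, t) = s • z + a + t • zb := rfl

theorem pos_of_isLorentzian (hL : m.IsLorentzian) (b : m.orthogonalPair z zb) (hb : b ≠ 0) :
    0 < m.form b b := by
  have hz0 : z ≠ 0 := by
    rintro rfl
    simpa using h.form_left_right
  obtain ⟨h1, h2⟩ := hL.form_self_of_orthogonal hz0 h.form_left (form_left_coe b)
  refine h1.lt_of_ne' fun h0 => hb ?_
  obtain ⟨c, hc⟩ := h2 h0
  have h3 := form_right_coe b
  rw [hc, map_smul, h.form_right_left, smul_eq_mul, mul_one] at h3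
  rw [h3, zero_smul] at hc
  exact Subtype.ext hc

end IsHyperbolicPair

/-- The metric induced on a subspace on which the form is positive definite. -/
def restrictPos (m : LieMetric V) (W : Submodule ℝ V)
    (h : ∀ b : W, b ≠ 0 → 0 < m.form b b) : LieMetric W where
  form := m.form.restrict W
  symm := ⟨fun u v => m.form_comm u v⟩
  nondegenerate := by
    refine ⟨fun u hu => ?_, fun u hu => ?_⟩ <;>
    · by_contra h0
      exact (h u h0).ne' (hu u)

end LinearAlgebra

/-! ### Null central vectors of a flat Lorentzian Lie algebra -/

/-- The radical of the restriction of the metric to a degenerate center contains a nonzero `z`; such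
a `z` is central, and null because it is orthogonal to itself. -/
theorem exists_mem_center_of_hasDegenerateCenter {g : Type*} [LieRing g] [LieAlgebra ℝ g]
    {m : LieMetric g} (hZ : m.HasDegenerateCenter) :
    ∃ z : g, z ≠ 0 ∧ (∀ u : g, ⁅u, z⁆ = 0) ∧
      ∀ c : g, (∀ u : g, ⁅u, c⁆ = 0) → m.form z c = 0 := by
  by_contra! hcon
  have key : ∀ z : LieAlgebra.center ℝ g, (∀ c : LieAlgebra.center ℝ g, m.form z c = 0) →
      z = 0 := by
    intro z hz
    by_contra hz0
    obtain ⟨c, hc, hc'⟩ := hcon z (fun h => hz0 (Subtype.ext h))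
      (fun u => (LieModule.mem_maxTrivSubmodule ℝ g g _).1 z.2 u)
    exact hc' (hz ⟨c, (LieModule.mem_maxTrivSubmodule ℝ g g _).2 hc⟩)
  refine hZ ⟨fun z hz => key z hz, fun z hz => key z fun c => ?_⟩
  rw [m.form_comm]
  exact hz c

/-- A null central vector `z` of a flat Lorentzian Lie algebra is annihilated by all left
multiplications. Since `L_z = R_z` commutes with every `L_u`, one has `L_z (L_z u) = L_u (z z) = 0`,
so the image of the skew map `L_z` is totally null and orthogonal to `z`, hence contained in `ℝ z`;
a skew map of rank at most one vanishes. -/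
theorem IsFlat.prod_eq_zero_of_null_central {g : Type*} [LieRing g] [LieAlgebra ℝ g]
    [FiniteDimensional ℝ g] {m : LieMetric g} (hf : m.IsFlat) (hL : m.IsLorentzian) {z : g}
    (hz0 : z ≠ 0) (hz : m.form z z = 0) (hc : ∀ u : g, ⁅u, z⁆ = 0) (u : g) :
    m.prod u z = 0 := by
  have hc' : ∀ u : g, ⁅z, u⁆ = 0 := fun u => by rw [← lie_skew, hc, neg_zero]
  have hcomm : ∀ u, m.prod u z = m.prod z u := fun u => by
    rw [← sub_eq_zero, m.prod_sub_prod, hc]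
  have hzz : m.prod z z = 0 := m.prod_eq_of_koszul fun w => by simp [hc]
  have hsq : ∀ u, m.prod z (m.prod z u) = 0 := fun u => by
    have h := m.isFlat_iff.1 hf z u z
    rw [hc', hzz, map_zero, LinearMap.zero_apply, map_zero, sub_zero] at h
    rw [← hcomm u, ← h]
  have hmul : ∀ u, ∃ c : ℝ, m.prod z u = c • z := fun u => by
    refine (hL.form_self_of_orthogonal hz0 hz ?_).2 ?_
    · have := m.form_prod_left z z u
      rw [hzz] at this
      simpa using this.symm
    · rw [m.form_prod_left, hsq, map_zero, neg_zero]
  have hne : ∀ u, m.form z u ≠ 0 → m.prod z u = 0 := fun u hu => by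
    obtain ⟨c, hcu⟩ := hmul u
    have h := m.form_prod_left z u u
    rw [m.form_comm u, hcu, map_smul, LinearMap.smul_apply, smul_eq_mul] at h
    have h0 : c * m.form z u = 0 := by linarith
    rw [hcu, (mul_eq_zero.1 h0).resolve_right hu, zero_smul]
  rw [hcomm]
  by_cases hu : m.form z u = 0
  · obtain ⟨zb, hzb⟩ := exists_isHyperbolicPair hz0 hz
    have h1 := hne zb (by simp [hzb.form_left_right])
    have h2 := hne (u + zb) (by simp [hu, hzb.form_left_right])
    rwa [map_add, h1, add_zero] at h2
  · exact hne u hu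

end LieMetric

/-! ### Reduction by a null central vector -/

/-- The Lie ring structure `(a, b) ↦ π ⁅a, b⁆` on a subspace `W`, for a linear map `π` to `W`
such that brackets with elements of `W` depend on `⁅b, c⁆` only through `π ⁅b, c⁆`, after applying
`π`. -/
abbrev LieRing.ofProj {g : Type*} [LieRing g] [LieAlgebra ℝ g] (W : Submodule ℝ g) (π : g →ₗ[ℝ] W)
    (hπ : ∀ a b c : W, π ⁅(a : g), (π ⁅(b : g), (c : g)⁆ : g)⁆ =
      π ⁅(a : g), ⁅(b : g), (c : g)⁆⁆) : LieRing W where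
  bracket a b := π ⁅(a : g), (b : g)⁆
  add_lie a b c := by
    change π ⁅((a + b : W) : g), (c : g)⁆ = π ⁅(a : g), (c : g)⁆ + π ⁅(b : g), (c : g)⁆
    rw [Submodule.coe_add, add_lie, map_add]
  lie_add a b c := by
    change π ⁅(a : g), ((b + c : W) : g)⁆ = π ⁅(a : g), (b : g)⁆ + π ⁅(a : g), (c : g)⁆
    rw [Submodule.coe_add, lie_add, map_add]
  lie_self a := by
    change π ⁅(a : g), (a : g)⁆ = 0
    rw [lie_self, map_zero]
  leibniz_lie a b c := by
    change π ⁅(a : g), (π ⁅(b : g), (c : g)⁆ : g)⁆ =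
      π ⁅(π ⁅(a : g), (b : g)⁆ : g), (c : g)⁆ + π ⁅(b : g), (π ⁅(a : g), (c : g)⁆ : g)⁆
    rw [← lie_skew (π ⁅(a : g), (b : g)⁆ : g) (c : g), map_neg π, hπ, hπ, hπ, ← map_neg,
      lie_skew, ← map_add, ← leibniz_lie]

/-- The Lie algebra structure on a subspace for the bracket of `LieRing.ofProj`. -/
abbrev LieAlgebra.ofProj {g : Type*} [LieRing g] [LieAlgebra ℝ g] (W : Submodule ℝ g)
    (π : g →ₗ[ℝ] W)
    (hπ : ∀ a b c : W, π ⁅(a : g), (π ⁅(b : g), (c : g)⁆ : g)⁆ =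
      π ⁅(a : g), ⁅(b : g), (c : g)⁆⁆) :
    letI := LieRing.ofProj W π hπ
    LieAlgebra ℝ W :=
  letI := LieRing.ofProj W π hπ
  { lie_smul := fun r a b => by
      change π ⁅(a : g), ((r • b : W) : g)⁆ = r • π ⁅(a : g), (b : g)⁆
      rw [Submodule.coe_smul, lie_smul, map_smul] }

namespace LieMetric

/-- For a null central vector `z` of a flat Lorentzian Lie algebra and a null vector `z̄` with
`⟨z, z̄⟩ = 1`, the orthogonal complement of `{z, z̄}` with the projected bracket is a flat Riemannian
Lie algebra of which the given one is a double extension, with `ξ a = -pr (a z̄)`,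
`D a = pr [z̄, a]` and `b₀ = pr (z̄ z̄)`. -/
theorem IsFlat.exists_isDoubleExtension {g : Type u} [LieRing g] [LieAlgebra ℝ g]
    [FiniteDimensional ℝ g] {m : LieMetric g} (hf : m.IsFlat) (hL : m.IsLorentzian)
    (hZ : m.HasDegenerateCenter) :
    ∃ (B : Type u) (_ : LieRing B) (_ : LieAlgebra ℝ B) (_ : FiniteDimensional ℝ B)
      (m₀ : LieMetric B) (ξ D : Module.End ℝ B) (b₀ : B),
      m₀.IsRiemannian ∧ m₀.IsFlat ∧ m₀.IsAdmissible ξ D 0 b₀ ∧ (D, b₀) ≠ (0, 0) ∧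
      m.IsDoubleExtension m₀ ξ D 0 b₀ := by
  obtain ⟨z, hz0, hc, hperp⟩ := exists_mem_center_of_hasDegenerateCenter hZ
  have hz : m.form z z = 0 := hperp z hc
  obtain ⟨zb, h⟩ := exists_isHyperbolicPair hz0 hz
  have hc' : ∀ u : g, ⁅z, u⁆ = 0 := fun u => by rw [← lie_skew, hc, neg_zero]
  have hlie : ∀ u v : g, m.form z ⁅u, v⁆ = 0 := fun u v => by
    have h1 := m.form_prod_left u v z
    have h2 := m.form_prod_left v u z
    rw [hf.prod_eq_zero_of_null_central hL hz0 hz hc, map_zero, neg_zero] at h1 h2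
    rw [m.form_comm, ← m.prod_sub_prod, map_sub, LinearMap.sub_apply, h1, h2, sub_zero]
  have hπ : ∀ a b c : m.orthogonalPair z zb, h.proj ⁅(a : g), (h.proj ⁅(b : g), (c : g)⁆ : g)⁆ =
      h.proj ⁅(a : g), ⁅(b : g), (c : g)⁆⁆ := fun a b c => by
    rw [h.coe_proj ⁅(b : g), (c : g)⁆, hlie, zero_smul, sub_zero, lie_sub, lie_smul, hc, smul_zero,
      sub_zero]
  let i1 : LieRing (m.orthogonalPair z zb) := LieRing.ofProj _ h.proj hπ
  let i2 : LieAlgebra ℝ (m.orthogonalPair z zb) := LieAlgebra.ofProj _ h.proj hπ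
  have hbr : ∀ a b : m.orthogonalPair z zb, ⁅a, b⁆ = h.proj ⁅(a : g), (b : g)⁆ := fun a b => rfl
  let m₀ : LieMetric (m.orthogonalPair z zb) := m.restrictPos _ (h.pos_of_isLorentzian hL)
  have hm₀ : ∀ a b, m₀.form a b = m.form a b := fun a b => rfl
  let ξ : Module.End ℝ (m.orthogonalPair z zb) :=
    -(h.proj ∘ₗ m.R zb ∘ₗ (m.orthogonalPair z zb).subtype)
  let D : Module.End ℝ (m.orthogonalPair z zb) :=
    h.proj ∘ₗ LieAlgebra.ad ℝ g zb ∘ₗ (m.orthogonalPair z zb).subtype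
  let b₀ : m.orthogonalPair z zb := h.proj (m.prod zb zb)
  have hξ : ∀ a, ξ a = -h.proj (m.prod a zb) := fun a => rfl
  have hD : ∀ a, D a = h.proj ⁅zb, (a : g)⁆ := fun a => rfl
  have hskew : m₀.IsSkew (D - ξ) := fun a b => by
    have h1 : ∀ a, (D - ξ) a = h.proj (m.prod zb a) := fun a => by
      rw [LinearMap.sub_apply, hD, hξ, sub_neg_eq_add, ← map_add, ← m.prod_sub_prod, sub_add_cancel]
    rw [m₀.form_comm a, hm₀, hm₀, h1, h1, h.form_proj, h.form_proj, m.form_prod_left, m.form_comm]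
  have hm : ∀ u v : g, m.form u v = doubleExtForm m₀ (h.split u) (h.split v) := by
    intro u v
    obtain ⟨⟨s, a, t⟩, rfl⟩ := h.split.symm.surjective u
    obtain ⟨⟨s', b, t'⟩, rfl⟩ := h.split.symm.surjective v
    rw [h.split.apply_symm_apply, h.split.apply_symm_apply, h.split_symm_apply, h.split_symm_apply]
    simp only [doubleExtForm, hm₀]
    simp only [map_add, map_smul, LinearMap.add_apply, LinearMap.smul_apply, smul_eq_mul,
      h.form_left, h.form_right, h.form_left_right, h.form_right_left, form_left_coe,
      form_right_coe, m.form_comm (a : g) z, m.form_comm (a : g) zb]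
    ring
  have he : ∀ u v : g,
      h.split ⁅u, v⁆ = doubleExtBracket m₀ ξ D 0 b₀ (h.split u) (h.split v) := by
    intro u v
    obtain ⟨⟨s, a, t⟩, rfl⟩ := h.split.symm.surjective u
    obtain ⟨⟨s', b, t'⟩, rfl⟩ := h.split.symm.surjective v
    have hlhs : ⁅h.split.symm (s, a, t), h.split.symm (s', b, t')⁆ =
        ⁅(a : g), (b : g)⁆ - t' • ⁅zb, (a : g)⁆ + t • ⁅zb, (b : g)⁆ := by
      simp only [h.split_symm_apply, add_lie, lie_add, smul_lie, lie_smul, hc, hc', smul_zero,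
        lie_self, ← lie_skew (a : g) zb]
      module
    rw [hlhs, h.split_apply]
    simp only [LinearEquiv.apply_symm_apply, doubleExtBracket]
    refine Prod.ext ?_ (Prod.ext ?_ ?_)
    · have hb : ∀ c : m.orthogonalPair z zb, m.form zb ⁅zb, (c : g)⁆ = -m₀.form b₀ c := fun c => by
        have h1 := m.two_mul_form_prod zb zb c
        rw [lie_self, map_zero, LinearMap.zero_apply, ← lie_skew, map_neg, LinearMap.neg_apply,
          m.form_comm ⁅zb, (c : g)⁆] at h1
        rw [hm₀, h.form_proj]
        linarith
      have hω : m.form zb ⁅(a : g), (b : g)⁆ = m₀.form (ξ a) b - m₀.form a (ξ b) := by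
        have h1 := m.two_mul_form_prod a zb b
        have h2 := m.two_mul_form_prod b zb a
        rw [m₀.form_comm a, hm₀, hm₀, hξ, hξ]
        simp only [Submodule.coe_neg, map_neg, LinearMap.neg_apply, h.form_proj]
        rw [← lie_skew (b : g) (a : g), map_neg, LinearMap.neg_apply, m.form_comm _ zb] at h1
        rw [m.form_comm _ zb] at h2
        linarith
      simp only [map_add, map_sub, map_smul, smul_eq_mul, hb, hω]
      ring
    · simp only [map_add, map_sub, map_smul, hD, hbr]
      abel
    · simp [hlie]
  obtain ⟨hf₀, hcoc, hcomm, hcompat⟩ := (isFlat_iff_of_doubleExt hskew he hm).1 hf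
  refine ⟨m.orthogonalPair z zb, i1, i2, inferInstance, m₀, ξ, D, b₀, h.pos_of_isLorentzian hL, hf₀,
    ⟨hcoc, derivation_of_doubleExt he, hskew, ?_, hcompat⟩, ?_, h.split, he, hm⟩
  · ext1 a
    simpa [Ring.lie_def, sq] using hcomm a
  · -- Otherwise `z̄` would be central, although `z` is orthogonal to the center.
    intro h0
    obtain ⟨hD0, hb0⟩ := Prod.ext_iff.1 h0
    have hcen : ∀ u : g, ⁅u, zb⁆ = 0 := fun u => by
      apply h.split.injective
      have h1 : h.split zb = (0, 0, 1) := by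
        rw [← LinearEquiv.eq_symm_apply]
        simp [h.split_symm_apply]
      rw [he, h1]
      simp only at hD0 hb0
      simp [doubleExtBracket, hD0, hb0]
    exact one_ne_zero (h.form_left_right.symm.trans (hperp zb hcen))

end LieMetric

/-! ### Continuation of integral curves -/

section Continuation

open Set Filter Topology

variable {E : Type*} [NormedAddCommGroup E] [NormedSpace ℝ E] [CompleteSpace E]
  {H : Type*} [TopologicalSpace H] {I : ModelWithCorners ℝ E H}
  {M : Type*} [TopologicalSpace M] [ChartedSpace H M] [IsManifold I 1 M] [T2Space M]
  [BoundarylessManifold I M]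

/-- If every integral curve starting at `x` and coming close to a time `b` can be continued past
`b`, then the integral curve starting at `x` is defined for all times. -/
theorem exists_isMIntegralCurve_of_continuation {v : (x : M) → TangentSpace I x}
    (hv : CMDiff 1 (fun x ↦ (⟨x, v x⟩ : TangentBundle I M))) (x : M)
    (h : ∀ b : ℝ, ∃ ε > 0, ∀ (a : ℝ) (γ : ℝ → M), γ 0 = x → IsMIntegralCurveOn γ v (Ioo (-a) a) →
      ∀ t ∈ Ioo (-a) a, |t - b| < ε →
        ∃ η : ℝ → M, η t = γ t ∧ IsMIntegralCurveOn η v (Ioo (b - ε) (b + ε))) :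
    ∃ γ : ℝ → M, γ 0 = x ∧ IsMIntegralCurve γ v := by
  let s := { a | ∃ γ, γ 0 = x ∧ IsMIntegralCurveOn γ v (Ioo (-a) a) }
  suffices hbdd : ¬BddAbove s by
    rw [not_bddAbove_iff] at hbdd
    rw [exists_isMIntegralCurve_iff_exists_isMIntegralCurveOn_Ioo hv]
    intro a
    obtain ⟨y, ⟨γ, hγ1, hγ2⟩, hlt⟩ := hbdd a
    exact ⟨γ, hγ1, hγ2.mono <| Ioo_subset_Ioo (neg_le_neg hlt.le) hlt.le⟩
  intro hbdd
  obtain ⟨γ₀, hγ₀, hγ₀'⟩ :=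
    exists_isMIntegralCurveAt_of_contMDiffAt_boundaryless (t₀ := 0) (x₀ := x) hv.contMDiffAt
  obtain ⟨δ, hδ, hγ₀'⟩ := isMIntegralCurveAt_iff'.1 hγ₀'
  rw [Real.ball_eq_Ioo, zero_sub, zero_add] at hγ₀'
  have hδs : δ ∈ s := ⟨γ₀, hγ₀, hγ₀'⟩
  set c := sSup s
  have hδc : δ ≤ c := le_csSup hbdd hδs
  obtain ⟨ε₁, hε₁, h₁⟩ := h c
  obtain ⟨ε₂, hε₂, h₂⟩ := h (-c)
  set ε := min ε₁ ε₂
  have hε : 0 < ε := lt_min hε₁ hε₂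
  have hεε₁ : ε ≤ ε₁ := min_le_left _ _
  have hεε₂ : ε ≤ ε₂ := min_le_right _ _
  obtain ⟨a, ⟨γ, h0, hγ⟩, hlt⟩ := exists_lt_of_lt_csSup ⟨δ, hδs⟩
    (show max (c - ε) 0 < c from max_lt (by linarith) (by linarith))
  have hac : a ≤ c := le_csSup hbdd ⟨γ, h0, hγ⟩
  obtain ⟨t, ht1, ht2⟩ := exists_between hlt
  have ht0 : 0 < t := (le_max_right _ _).trans_lt ht1
  have htε : c - ε < t := (le_max_left _ _).trans_lt ht1
  obtain ⟨η₁, hη₁, hη₁'⟩ := h₁ a γ h0 hγ t ⟨by linarith, ht2⟩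
    (abs_lt.2 ⟨by linarith, by linarith⟩)
  obtain ⟨η₂, hη₂, hη₂'⟩ := h₂ a γ h0 hγ (-t) ⟨by linarith, by linarith⟩
    (abs_lt.2 ⟨by linarith, by linarith⟩)
  have hleft := isMIntegralCurveOn_piecewise (t₀ := -t) hv hγ hη₂'
    ⟨⟨by linarith, by linarith⟩, ⟨by linarith, by linarith⟩⟩ hη₂.symm
  replace hleft := hleft.mono (s' := Ioo (-(c + ε)) a)
    (union_comm _ _ ▸ Ioo_subset_Ioo_union_Ioo (by linarith) (by linarith) le_rfl)
  have hboth := isMIntegralCurveOn_piecewise (t₀ := t) hv hleft hη₁'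
    ⟨⟨by linarith, by linarith⟩, ⟨by linarith, by linarith⟩⟩
    (by rw [piecewise, if_pos ⟨by linarith, ht2⟩, hη₁])
  replace hboth := hboth.mono (s' := Ioo (-(c + ε)) (c + ε))
    (Ioo_subset_Ioo_union_Ioo le_rfl (by linarith) (by linarith))
  have hmem : c + ε ∈ s := by
    refine ⟨_, ?_, hboth⟩
    rw [piecewise, if_pos ⟨by linarith, by linarith⟩, piecewise,
      if_pos ⟨by linarith, by linarith⟩, h0]
  linarith [le_csSup hbdd hmem]

end Continuation

/-! ### Ordinary differential equations of at most linear radial growth -/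

section LinearGrowth

open Set Filter Topology

theorem abs_le_mul_exp_of_abs_deriv_le {φ φ' : ℝ → ℝ} {K a : ℝ}
    (hφ : ∀ t ∈ Ioo (-a) a, HasDerivAt φ (φ' t) t) (hK : ∀ t ∈ Ioo (-a) a, |φ' t| ≤ K * |φ t|)
    {t : ℝ} (ht : t ∈ Ioo (-a) a) : |φ t| ≤ |φ 0| * Real.exp (K * |t|) := by
  have key : ∀ ψ ψ' : ℝ → ℝ, (∀ t ∈ Ioo (-a) a, HasDerivAt ψ (ψ' t) t) →
      (∀ t ∈ Ioo (-a) a, |ψ' t| ≤ K * |ψ t|) → ∀ t, 0 ≤ t → t < a →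
      |ψ t| ≤ |ψ 0| * Real.exp (K * t) := by
    intro ψ ψ' h1 h2 t h0 hta
    have hsub : ∀ s ∈ Icc 0 t, s ∈ Ioo (-a) a := fun s hs => ⟨by linarith [hs.1], by linarith [hs.2]⟩
    have := norm_le_gronwallBound_of_norm_deriv_right_le (f := ψ) (f' := ψ') (δ := |ψ 0|) (K := K)
      (ε := 0) (a := 0) (b := t)
      (fun s hs => (h1 s (hsub s hs)).continuousAt.continuousWithinAt)
      (fun s hs => (h1 s (hsub s (Ico_subset_Icc_self hs))).hasDerivWithinAt) le_rfl
      (fun s hs => by simpa using h2 s (hsub s (Ico_subset_Icc_self hs))) t ⟨h0, le_rfl⟩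
    rwa [gronwallBound_ε0, sub_zero] at this
  rcases le_total 0 t with h0 | h0
  · rw [abs_of_nonneg h0]
    exact key φ φ' hφ hK t h0 ht.2
  · rw [abs_of_nonpos h0]
    have := key (fun s => φ (-s)) (fun s => -φ' (-s))
      (fun s hs => by
        have h1 := hφ (-s) ⟨by linarith [hs.2], by linarith [hs.1]⟩
        have h2 := h1.comp s (hasDerivAt_neg s)
        rwa [mul_neg_one] at h2)
      (fun s hs => by simpa using hK (-s) ⟨by linarith [hs.2], by linarith [hs.1]⟩)
      (-t) (by linarith) (by linarith [ht.1])
    simpa using this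

variable {E : Type*} [NormedAddCommGroup E] [InnerProductSpace ℝ E] [FiniteDimensional ℝ E]

/-- The time of existence of solutions of an autonomous `C¹` equation is bounded below on compact
sets of initial values. -/
theorem IsCompact.exists_uniform_solution_time {f : E → E} (hf : ContDiff ℝ 1 f) {K : Set E}
    (hK : IsCompact K) : ∃ ε > 0, ∀ x ∈ K, ∃ α : ℝ → E, α 0 = x ∧
      ∀ t ∈ Ioo (-ε) ε, HasDerivAt α (f (α t)) t := by
  refine hK.induction_on ⟨1, one_pos, by simp⟩ ?_ ?_ ?_
  · rintro s t hst ⟨ε, hε, h⟩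
    exact ⟨ε, hε, fun x hx => h x (hst hx)⟩
  · rintro s t ⟨ε, hε, h⟩ ⟨ε', hε', h'⟩
    refine ⟨min ε ε', lt_min hε hε', fun x hx => ?_⟩
    rcases hx with hx | hx
    · obtain ⟨α, h0, hα⟩ := h x hx
      exact ⟨α, h0, fun t ht => hα t ⟨(neg_le_neg (min_le_left _ _)).trans_lt ht.1,
        ht.2.trans_le (min_le_left _ _)⟩⟩
    · obtain ⟨α, h0, hα⟩ := h' x hx
      exact ⟨α, h0, fun t ht => hα t ⟨(neg_le_neg (min_le_right _ _)).trans_lt ht.1,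
        ht.2.trans_le (min_le_right _ _)⟩⟩
  · intro x _
    obtain ⟨r, hr, ε, hε, h⟩ :=
      hf.contDiffAt.exists_forall_mem_closedBall_exists_eq_forall_mem_Ioo_hasDerivAt (x₀ := x) 0
    rw [zero_sub, zero_add] at h
    exact ⟨Metric.closedBall x r, mem_nhdsWithin_of_mem_nhds (Metric.closedBall_mem_nhds x hr),
      ε, hε, h⟩

/-- A `C¹` differential equation `x' = f x` with `⟨x, f x⟩ = O(1 + ‖x‖²)` has global solutions: by
Grönwall's inequality `1 + ‖x‖²` grows at most exponentially. -/
theorem exists_forall_hasDerivAt_of_abs_inner_le {f : E → E} (hf : ContDiff ℝ 1 f) {C : ℝ}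
    (hC : ∀ x, |inner ℝ x (f x)| ≤ C * (1 + ‖x‖ ^ 2)) (x₀ : E) :
    ∃ x : ℝ → E, x 0 = x₀ ∧ ∀ t, HasDerivAt x (f (x t)) t := by
  let v : (x : E) → TangentSpace 𝓘(ℝ, E) x := f
  have hv : CMDiff 1 (fun x ↦ (⟨x, v x⟩ : TangentBundle 𝓘(ℝ, E) E)) :=
    contMDiff_vectorSpace_iff_contDiff.2 hf
  have hconv : ∀ {γ : ℝ → E} {t : ℝ}, HasMFDerivAt% γ t ((1 : ℝ →L[ℝ] ℝ).smulRight (v (γ t))) ↔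
      HasDerivAt γ (f (γ t)) t := fun {γ t} => by
    have h1 : ∀ w : E, ContinuousLinearMap.smulRight (1 : ℝ →L[ℝ] ℝ) w =
        ContinuousLinearMap.toSpanSingleton ℝ w := fun w => by
      ext
      simp
    exact hasMFDerivAt_iff_hasFDerivAt.trans
      (by rw [hasDerivAt_iff_hasFDerivAt, ← h1]; exact Iff.rfl)
  suffices ∃ γ : ℝ → E, γ 0 = x₀ ∧ IsMIntegralCurve γ v by
    obtain ⟨γ, h0, hγ⟩ := this
    exact ⟨γ, h0, fun t => hconv.1 (hγ t)⟩
  have hbound : ∀ (a : ℝ) (γ : ℝ → E), γ 0 = x₀ → IsMIntegralCurveOn γ v (Ioo (-a) a) →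
      ∀ t ∈ Ioo (-a) a, 1 + ‖γ t‖ ^ 2 ≤ (1 + ‖x₀‖ ^ 2) * Real.exp (2 * C * |t|) := by
    intro a γ h0 hγ t ht
    have hpos : ∀ s, |1 + ‖γ s‖ ^ 2| = 1 + ‖γ s‖ ^ 2 := fun s => abs_of_pos (by positivity)
    have := abs_le_mul_exp_of_abs_deriv_le (φ := fun t => 1 + ‖γ t‖ ^ 2)
      (φ' := fun t => 2 * inner ℝ (γ t) (f (γ t))) (K := 2 * C) (a := a)
      (fun s hs => (hconv.1 ((hγ s hs).hasMFDerivAt (Ioo_mem_nhds hs.1 hs.2))).norm_sq.const_add 1)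
      (fun s _ => by
        rw [hpos, abs_mul, abs_two, mul_assoc]
        exact mul_le_mul_of_nonneg_left (hC _) two_pos.le) ht
    simp only [hpos] at this
    rwa [h0] at this
  refine exists_isMIntegralCurve_of_continuation hv x₀ fun b => ?_
  have hC0 : 0 ≤ C := by simpa using hC 0
  set R := (1 + ‖x₀‖ ^ 2) * Real.exp (2 * C * (|b| + 1))
  obtain ⟨ε, hε, hsol⟩ :=
    (ProperSpace.isCompact_closedBall (0 : E) R).exists_uniform_solution_time hf
  refine ⟨min (ε / 2) 1, by positivity, fun a γ h0 hγ t ht htb => ?_⟩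
  have hmin1 : min (ε / 2) 1 ≤ ε / 2 := min_le_left _ _
  have hmin2 : min (ε / 2) 1 ≤ 1 := min_le_right _ _
  have htb1 : |t| ≤ |b| + 1 := by
    have := abs_add_le b (t - b)
    rw [add_sub_cancel] at this
    linarith
  have hmem : γ t ∈ Metric.closedBall (0 : E) R := by
    rw [mem_closedBall_zero_iff]
    have h1 : (1 + ‖x₀‖ ^ 2) * Real.exp (2 * C * |t|) ≤ R := by
      have h2 : Real.exp (2 * C * |t|) ≤ Real.exp (2 * C * (|b| + 1)) :=
        Real.exp_le_exp.2 (mul_le_mul_of_nonneg_left htb1 (by positivity))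
      exact mul_le_mul_of_nonneg_left h2 (by positivity)
    nlinarith [hbound a γ h0 hγ t ht, sq_nonneg (‖γ t‖ - 1), norm_nonneg (γ t)]
  obtain ⟨η, hη, hη'⟩ := hsol _ hmem
  refine ⟨fun s => η (s - t), by simpa using hη, fun s hs => HasMFDerivAt.hasMFDerivWithinAt ?_⟩
  obtain ⟨h1, h2⟩ := abs_lt.1 htb
  exact hconv.2 ((hη' (s - t) ⟨by linarith [hs.1], by linarith [hs.2]⟩).comp_sub_const s t)

end LinearGrowth

/-! ### The Euler equation of a double extension -/

section Euler

variable {E : Type*} [NormedAddCommGroup E] [InnerProductSpace ℝ E] [FiniteDimensional ℝ E]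

/-- The Euler equation of a left-invariant metric on a double extension, in the coordinates
`(s, a, t)`, has global solutions. The coordinate `t` is constant, `a` solves an equation whose
quadratic part `-P a a` is orthogonal to `a`, and `s` is obtained from `a` by integration. -/
theorem exists_forall_hasDerivAt_euler (P : E →ₗ[ℝ] E →ₗ[ℝ] E) (hP : ∀ a, inner ℝ a (P a a) = 0)
    (S ξ : E →ₗ[ℝ] E) (hS : ∀ a, inner ℝ a (S a) = 0) (b₀ : E) (x₀ : ℝ × E × ℝ) :
    ∃ x : ℝ → ℝ × E × ℝ, x 0 = x₀ ∧ ∀ τ, HasDerivAt x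
      (-(inner ℝ (ξ (x τ).2.1) (x τ).2.1 - (x τ).2.2 * inner ℝ b₀ (x τ).2.1,
        P (x τ).2.1 (x τ).2.1 + (x τ).2.2 • S (x τ).2.1 - (x τ).2.2 • ξ (x τ).2.1 +
          ((x τ).2.2 * (x τ).2.2) • b₀, 0)) τ := by
  obtain ⟨s₀, a₀, t⟩ := x₀
  let P' := P.toContinuousBilinearMap
  let S' := S.toContinuousLinearMap
  let ξ' := ξ.toContinuousLinearMap
  have hf : ContDiff ℝ 1 fun a : E => -(P' a a + t • S' a - t • ξ' a + (t * t) • b₀) := by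
    fun_prop
  obtain ⟨a, ha0, ha⟩ := exists_forall_hasDerivAt_of_abs_inner_le hf
    (C := |t| * ‖ξ'‖ + |t * t| * ‖b₀‖) (fun a => by
      have h1 : inner ℝ a (-(P' a a + t • S' a - t • ξ' a + (t * t) • b₀)) =
          t * inner ℝ a (ξ' a) - (t * t) * inner ℝ a b₀ := by
        have e1 : inner ℝ a (P' a a) = 0 := hP a
        have e2 : inner ℝ a (S' a) = 0 := hS a
        simp only [inner_neg_right, inner_add_right, inner_sub_right, inner_smul_right, e1, e2]
        ring
      have h2 : |inner ℝ a (ξ' a)| ≤ ‖ξ'‖ * ‖a‖ ^ 2 := by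
        calc |inner ℝ a (ξ' a)| ≤ ‖a‖ * ‖ξ' a‖ := abs_real_inner_le_norm _ _
          _ ≤ ‖a‖ * (‖ξ'‖ * ‖a‖) := by gcongr; exact ξ'.le_opNorm a
          _ = ‖ξ'‖ * ‖a‖ ^ 2 := by ring
      have h3 : |inner ℝ a b₀| ≤ ‖b₀‖ * (1 + ‖a‖ ^ 2) := by
        calc |inner ℝ a b₀| ≤ ‖a‖ * ‖b₀‖ := abs_real_inner_le_norm _ _
          _ ≤ (1 + ‖a‖ ^ 2) * ‖b₀‖ := by
            gcongr
            nlinarith [sq_nonneg (‖a‖ - 1)]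
          _ = ‖b₀‖ * (1 + ‖a‖ ^ 2) := by ring
      rw [h1]
      calc |t * inner ℝ a (ξ' a) - (t * t) * inner ℝ a b₀|
          ≤ |t * inner ℝ a (ξ' a)| + |(t * t) * inner ℝ a b₀| := abs_sub _ _
        _ = |t| * |inner ℝ a (ξ' a)| + |t * t| * |inner ℝ a b₀| := by rw [abs_mul, abs_mul (t * t)]
        _ ≤ |t| * (‖ξ'‖ * (1 + ‖a‖ ^ 2)) + |t * t| * (‖b₀‖ * (1 + ‖a‖ ^ 2)) := by
          gcongr
          exact h2.trans (by gcongr; linarith)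
        _ = _ := by ring) a₀
  have hac : Continuous a := continuous_iff_continuousAt.2 fun τ => (ha τ).continuousAt
  let q : ℝ → ℝ := fun τ => -(inner ℝ (ξ' (a τ)) (a τ) - t * inner ℝ b₀ (a τ))
  have hq : Continuous q := by fun_prop
  refine ⟨fun τ => (s₀ + ∫ σ in (0 : ℝ)..τ, q σ, a τ, t), by simp [ha0], fun τ => ?_⟩
  have hs := (hq.integral_hasStrictDerivAt 0 τ).hasDerivAt.const_add s₀
  have h := hs.prodMk ((ha τ).prodMk (hasDerivAt_const τ t))
  convert! h using 1
  simp [q, P', S', ξ']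

end Euler

/-! ### Time-dependent left-invariant vector fields on Lie groups -/

section LieGroup

open Set Filter Topology Bundle

variable {n : ℕ} {G : Type*} [TopologicalSpace G] [ChartedSpace (EuclideanSpace ℝ (Fin n)) G]
  [Group G]

/-- The vector field `(g, s) ↦ (dL_g (x s), 1)` on `G × ℝ`, whose integral curves with `s = t` are
the graphs of the solutions of `γ' = dL_γ x`. -/
def suspendedField (x : ℝ → GroupLieAlgebra (𝓡 n) G) (p : G × ℝ) :
    TangentSpace ((𝓡 n).prod 𝓘(ℝ, ℝ)) p :=
  ((mulInvariantVectorField (x p.2) p.1 : TangentSpace (𝓡 n) p.1), (1 : ℝ))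

theorem hasMFDerivAt_suspendedField_iff {x : ℝ → EuclideanSpace ℝ (Fin n)} {γ : ℝ → G × ℝ}
    {t : ℝ} :
    HasMFDerivAt 𝓘(ℝ, ℝ) ((𝓡 n).prod 𝓘(ℝ, ℝ)) γ t
      ((1 : ℝ →L[ℝ] ℝ).smulRight (suspendedField (n := n) (G := G) x (γ t))) ↔
    HasMFDerivAt 𝓘(ℝ, ℝ) (𝓡 n) (fun s => (γ s).1) t ((1 : ℝ →L[ℝ] ℝ).smulRight
      (mulInvariantVectorField (x (γ t).2 : GroupLieAlgebra (𝓡 n) G) (γ t).1)) ∧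
    HasDerivAt (fun s => (γ s).2) 1 t := by
  constructor
  · intro h
    refine ⟨(hasMFDerivAt_fst (I := 𝓡 n) (I' := 𝓘(ℝ, ℝ)) (γ t)).comp t h, ?_⟩
    have h2 := (hasMFDerivAt_snd (I := 𝓡 n) (I' := 𝓘(ℝ, ℝ)) (γ t)).comp t h
    have h3 : HasFDerivAt (fun s => (γ s).2) ((1 : ℝ →L[ℝ] ℝ).smulRight (1 : ℝ)) t :=
      hasMFDerivAt_iff_hasFDerivAt.1 h2
    simpa using h3.hasDerivAt
  · rintro ⟨h1, h2⟩
    exact h1.prodMk (hasMFDerivAt_iff_hasFDerivAt.2 h2.hasFDerivAt)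

/-- Along an integral curve of the suspended field the second coordinate is time, up to a
constant. -/
theorem snd_eq_add_of_isMIntegralCurveOn {x : ℝ → EuclideanSpace ℝ (Fin n)} {γ : ℝ → G × ℝ}
    {c d : ℝ} (hγ : IsMIntegralCurveOn γ (suspendedField (n := n) (G := G) x) (Ioo c d)) {s t : ℝ}
    (hs : s ∈ Ioo c d) (ht : t ∈ Ioo c d) : (γ s).2 - s = (γ t).2 - t := by
  have hd : ∀ r ∈ Ioo c d, HasDerivAt (fun r => (γ r).2 - r) 0 r := fun r hr => by
    have h := (hasMFDerivAt_suspendedField_iff.1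
      ((hγ r hr).hasMFDerivAt (Ioo_mem_nhds hr.1 hr.2))).2.sub (hasDerivAt_id r)
    rwa [sub_self] at h
  exact isOpen_Ioo.is_const_of_deriv_eq_zero isPreconnected_Ioo
    (fun r hr => (hd r hr).differentiableAt.differentiableWithinAt) (fun r hr => (hd r hr).deriv)
    hs ht

variable [LieGroup (𝓡 n) ∞ G]

theorem isManifold_one_of_lieGroup : IsManifold (𝓡 n) 1 G :=
  IsManifold.of_le (n := ∞) (by norm_cast)

theorem mfderiv_mul_left_mulInvariantVectorField (q h : G) (w : GroupLieAlgebra (𝓡 n) G) :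
    mfderiv (𝓡 n) (𝓡 n) (q * ·) h (mulInvariantVectorField w h) =
      mulInvariantVectorField w (q * h) := by
  have hsm : ∀ r k : G, MDifferentiableAt (𝓡 n) (𝓡 n) (r * ·) k := fun r k =>
    (contMDiff_mul_left (I := 𝓡 n) (n := ∞)).mdifferentiableAt (by simp)
  have hcomp : (fun x => q * h * x) = (q * ·) ∘ (h * ·) := by
    ext x
    simp [mul_assoc]
  rw [mulInvariantVectorField, mulInvariantVectorField, hcomp]
  exact (mfderiv_comp_apply_of_eq (I' := 𝓡 n) _ (hsm q h) (hsm h 1) (mul_one h) w).symm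

/-- The inclusion of a fibre into the tangent bundle is smooth. -/
theorem contMDiff_tangentBundle_mk (p : G) : ContMDiff 𝓘(ℝ, EuclideanSpace ℝ (Fin n))
    (𝓡 n).tangent 1 fun w : EuclideanSpace ℝ (Fin n) =>
      (TotalSpace.mk' (EuclideanSpace ℝ (Fin n)) p w : TangentBundle (𝓡 n) G) := by
  have := isManifold_one_of_lieGroup (n := n) (G := G)
  intro w
  rw [contMDiffAt_totalSpace]
  refine ⟨contMDiffAt_const, ?_⟩
  have hp : p ∈ (trivializationAt (EuclideanSpace ℝ (Fin n))
      (TangentSpace (𝓡 n) : G → Type _) p).baseSet := mem_baseSet_trivializationAt _ _ _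
  let T : EuclideanSpace ℝ (Fin n) →L[ℝ] EuclideanSpace ℝ (Fin n) :=
    (trivializationAt (EuclideanSpace ℝ (Fin n))
      (TangentSpace (𝓡 n) : G → Type _) p).continuousLinearMapAt ℝ p
  refine (T.contDiff (n := 1)).contMDiff.contMDiffAt.congr_of_eventuallyEq (.of_forall fun w' => ?_)
  exact (Trivialization.continuousLinearMapAt_apply_of_mem _ _ hp w').symm

/-- The value at `p` of the left-invariant vector field of `w` is the derivative of the multiplication
at `(p, 1)` in the direction `(0, w)`. -/
theorem tangentMap_mul_zero_left (p : G) (w : EuclideanSpace ℝ (Fin n)) :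
    tangentMap ((𝓡 n).prod (𝓡 n)) (𝓡 n) (fun q : G × G => q.1 * q.2)
      ⟨(p, 1), ((0, w) : EuclideanSpace ℝ (Fin n) × EuclideanSpace ℝ (Fin n))⟩ =
        ⟨p, mulInvariantVectorField (w : GroupLieAlgebra (𝓡 n) G) p⟩ := by
  have h1 := mfderiv_prod_eq_add_apply (I := 𝓡 n) (I' := 𝓡 n) (p := ((p, 1) : G × G))
    (v := ((0, w) : EuclideanSpace ℝ (Fin n) × EuclideanSpace ℝ (Fin n)))
    ((contMDiff_mul (𝓡 n) (G := G) ∞).mdifferentiableAt (by simp))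
  have h2 : mfderiv (𝓡 n) (𝓡 n) (fun z : G => z * 1) p (0 : TangentSpace (𝓡 n) p) = 0 :=
    map_zero _
  have h3 : (mfderiv ((𝓡 n).prod (𝓡 n)) (𝓡 n) (fun q : G × G => q.1 * q.2) (p, 1)
      ((0, w) : EuclideanSpace ℝ (Fin n) × EuclideanSpace ℝ (Fin n)) : EuclideanSpace ℝ (Fin n)) =
      mulInvariantVectorField (w : GroupLieAlgebra (𝓡 n) G) p :=
    h1.trans ((congrArg (· + _) h2).trans (zero_add _))
  exact TotalSpace.ext (mul_one p) (heq_of_eq h3)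

theorem contMDiff_suspendedField (x : ℝ → EuclideanSpace ℝ (Fin n)) (hx : ContDiff ℝ 1 x) :
    ContMDiff ((𝓡 n).prod 𝓘(ℝ, ℝ)) ((𝓡 n).prod 𝓘(ℝ, ℝ)).tangent 1 fun p : G × ℝ =>
      (⟨p, suspendedField (n := n) (G := G) x p⟩ : TangentBundle ((𝓡 n).prod 𝓘(ℝ, ℝ)) (G × ℝ)) := by
  have := isManifold_one_of_lieGroup (n := n) (G := G)
  have : IsManifold (𝓡 n) (1 + 1) G := IsManifold.of_le (n := ∞) (by norm_cast)
  have h1 : ContMDiff ((𝓡 n).prod 𝓘(ℝ, ℝ)) (𝓡 n).tangent 1 fun p : G × ℝ =>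
      (⟨p.1, mulInvariantVectorField (x p.2 : GroupLieAlgebra (𝓡 n) G) p.1⟩ :
        TangentBundle (𝓡 n) G) := by
    have sfg : ContMDiff ((𝓡 n).prod 𝓘(ℝ, ℝ)) (𝓡 n).tangent 1 fun p : G × ℝ =>
        (TotalSpace.mk' (EuclideanSpace ℝ (Fin n)) p.1 0 : TangentBundle (𝓡 n) G) :=
      (contMDiff_zeroSection ℝ (TangentSpace (𝓡 n) : G → Type _)).comp contMDiff_fst
    have sfv : ContMDiff ((𝓡 n).prod 𝓘(ℝ, ℝ)) (𝓡 n).tangent 1 fun p : G × ℝ =>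
        (TotalSpace.mk' (EuclideanSpace ℝ (Fin n)) 1 (x p.2) : TangentBundle (𝓡 n) G) :=
      (contMDiff_tangentBundle_mk 1).comp (hx.contMDiff.comp contMDiff_snd)
    have S₂ : ContMDiff ((𝓡 n).tangent.prod (𝓡 n).tangent) ((𝓡 n).prod (𝓡 n)).tangent 1
        (equivTangentBundleProd (𝓡 n) G (𝓡 n) G).symm := contMDiff_equivTangentBundleProd_symm
    have S₃ : ContMDiff ((𝓡 n).prod (𝓡 n)).tangent (𝓡 n).tangent 1
        (tangentMap ((𝓡 n).prod (𝓡 n)) (𝓡 n) fun p : G × G => p.1 * p.2) :=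
      ((contMDiff_mul (𝓡 n) ∞).of_le (by norm_cast)).contMDiff_tangentMap (n := 1 + 1) le_rfl
    refine ((S₃.comp S₂).comp (sfg.prodMk sfv)).congr fun p => ?_
    exact (tangentMap_mul_zero_left p.1 (x p.2)).symm
  have h2 : ContMDiff ((𝓡 n).prod 𝓘(ℝ, ℝ)) 𝓘(ℝ, ℝ).tangent 1 fun p : G × ℝ =>
      (⟨p.2, (1 : ℝ)⟩ : TangentBundle 𝓘(ℝ, ℝ) ℝ) :=
    (contMDiff_vectorSpace_iff_contDiff (V := fun _ : ℝ => (1 : ℝ)).2 contDiff_const).comp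
      contMDiff_snd
  exact (contMDiff_equivTangentBundleProd_symm (I := 𝓡 n) (I' := 𝓘(ℝ, ℝ)) (M := G)
    (M' := ℝ)).comp (h1.prodMk h2)

/-- A time-dependent left-invariant vector field on a Lie group is complete: a solution through the
identity at time `b`, left translated, continues every solution past `b`. -/
theorem exists_forall_hasMFDerivAt_mulInvariantVectorField [T2Space G]
    {x : ℝ → EuclideanSpace ℝ (Fin n)} (hx : ContDiff ℝ 1 x) (p : G) :
    ∃ γ : ℝ → G, γ 0 = p ∧ ∀ t, HasMFDerivAt 𝓘(ℝ, ℝ) (𝓡 n) γ t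
      ((1 : ℝ →L[ℝ] ℝ).smulRight
        (mulInvariantVectorField (x t : GroupLieAlgebra (𝓡 n) G) (γ t))) := by
  have := isManifold_one_of_lieGroup (n := n) (G := G)
  have hv := contMDiff_suspendedField (G := G) x hx
  suffices ∃ Γ : ℝ → G × ℝ, Γ 0 = (p, 0) ∧ IsMIntegralCurve Γ (suspendedField x) by
    obtain ⟨Γ, h0, hΓ⟩ := this
    refine ⟨fun t => (Γ t).1, by simp [h0], fun t => ?_⟩
    have h1 := (hasMFDerivAt_suspendedField_iff.1 (hΓ t)).1
    have h2 : (Γ t).2 = t := by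
      have h3 := snd_eq_add_of_isMIntegralCurveOn
        (hΓ.isMIntegralCurveOn (Ioo (-(|t| + 1)) (|t| + 1))) (s := t) (t := 0)
        (abs_lt.1 (lt_add_one _)) (by constructor <;> linarith [abs_nonneg t])
      simpa [h0, sub_eq_zero] using h3
    rwa [h2] at h1
  refine exists_isMIntegralCurve_of_continuation hv (p, 0) fun b => ?_
  obtain ⟨β, hβ, hβ'⟩ := exists_isMIntegralCurveAt_of_contMDiffAt_boundaryless (t₀ := b)
    (x₀ := ((1 : G), b)) hv.contMDiffAt
  obtain ⟨ε, hε, hβ'⟩ := isMIntegralCurveAt_iff'.1 hβ'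
  rw [Real.ball_eq_Ioo] at hβ'
  have hbε : b ∈ Ioo (b - ε) (b + ε) := ⟨by linarith, by linarith⟩
  refine ⟨ε, hε, fun a γ h0 hγ t ht htb => ?_⟩
  obtain ⟨htb1, htb2⟩ := abs_lt.1 htb
  have htε : t ∈ Ioo (b - ε) (b + ε) := ⟨by linarith, by linarith⟩
  have hγ2 : (γ t).2 = t := by
    have h1 := snd_eq_add_of_isMIntegralCurveOn hγ ht (t := 0)
      ⟨by linarith [ht.1, ht.2], by linarith [ht.1, ht.2]⟩
    simpa [h0, sub_eq_zero] using h1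
  have hβ2 : (β t).2 = t := by
    have h1 := snd_eq_add_of_isMIntegralCurveOn hβ' htε hbε
    simpa [hβ, sub_eq_zero] using h1
  set q := (γ t).1 * ((β t).1)⁻¹
  refine ⟨fun s => (q * (β s).1, (β s).2), ?_, fun s hs => HasMFDerivAt.hasMFDerivWithinAt ?_⟩
  · refine Prod.ext ?_ ?_
    · simp [q]
    · simp [hβ2, hγ2]
  · obtain ⟨h1, h2⟩ := hasMFDerivAt_suspendedField_iff.1
      ((hβ' s hs).hasMFDerivAt (Ioo_mem_nhds hs.1 hs.2))
    refine hasMFDerivAt_suspendedField_iff.2 ⟨?_, h2⟩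
    have hq := ((contMDiff_mul_left (I := 𝓡 n) (n := ∞) (a := q)).mdifferentiableAt
      (x := (β s).1) (by simp)).hasMFDerivAt
    have hcomp : ∀ (A : EuclideanSpace ℝ (Fin n) →L[ℝ] EuclideanSpace ℝ (Fin n))
        (w : EuclideanSpace ℝ (Fin n)),
        A.comp ((1 : ℝ →L[ℝ] ℝ).smulRight w) = (1 : ℝ →L[ℝ] ℝ).smulRight (A w) := fun A w => by
      ext
      simp
    have hmul : (mfderiv (𝓡 n) (𝓡 n) (q * ·) (β s).1
        (mulInvariantVectorField (x (β s).2 : GroupLieAlgebra (𝓡 n) G) (β s).1) :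
          EuclideanSpace ℝ (Fin n)) =
        mulInvariantVectorField (x (β s).2 : GroupLieAlgebra (𝓡 n) G) (q * (β s).1) :=
      mfderiv_mul_left_mulInvariantVectorField q (β s).1 _
    exact (hq.comp s h1).congr_mfderiv ((hcomp _ _).trans
      (congrArg (fun w => (1 : ℝ →L[ℝ] ℝ).smulRight w) hmul))

end LieGroup

/-! ### Completeness of double extensions -/

theorem contDiff_one_of_hasDerivAt_quadratic {F : Type*} [NormedAddCommGroup F] [NormedSpace ℝ F]
    [FiniteDimensional ℝ F] (P : F →ₗ[ℝ] F →ₗ[ℝ] F) {x : ℝ → F}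
    (hx : ∀ t, HasDerivAt x (-(P (x t) (x t))) t) : ContDiff ℝ 1 x := by
  have hc : Continuous x := continuous_iff_continuousAt.2 fun t => (hx t).continuousAt
  have hP : Continuous fun t => -(P.toContinuousBilinearMap (x t) (x t)) := by fun_prop
  exact contDiff_one_iff_deriv.2
    ⟨fun t => (hx t).differentiableAt, hP.congr fun t => (hx t).deriv.symm⟩

namespace LieMetric

/-- Transport of the global solutions of the Euler equation along a double extension isomorphism. -/
theorem IsDoubleExtension.exists_forall_hasDerivAt {n : ℕ} {G : Type*} [TopologicalSpace G]
    [ChartedSpace (EuclideanSpace ℝ (Fin n)) G] [Group G] [LieGroup (𝓡 n) ∞ G]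
    {m : LieMetric (GroupLieAlgebra (𝓡 n) G)}
    {B : Type*} [LieRing B] [LieAlgebra ℝ B] [FiniteDimensional ℝ B] {m₀ : LieMetric B}
    {ξ D : Module.End ℝ B} {b₀ : B} (hd : m.IsDoubleExtension m₀ ξ D 0 b₀)
    (hskew : m₀.IsSkew (D - ξ)) (hR : m₀.IsRiemannian) (v : GroupLieAlgebra (𝓡 n) G) :
    ∃ x : ℝ → GroupLieAlgebra (𝓡 n) G, x 0 = v ∧ ∀ t, HasDerivAt x (-(m.prod (x t) (x t))) t := by
  obtain ⟨e, he, hm⟩ := hd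
  let _ := hR.core.toNormedAddCommGroup
  let _ := InnerProductSpace.ofCore hR.core.toCore
  obtain ⟨y, hy0, hy⟩ := exists_forall_hasDerivAt_euler (E := B) m₀.prod
    (fun a => by
      have h := m₀.form_prod_left a a a
      rw [m₀.form_comm] at h
      change m₀.form a (m₀.prod a a) = 0
      linarith) (D - ξ) ξ
    (fun a => by
      have h := hskew a a
      rw [m₀.form_comm] at h
      change m₀.form a ((D - ξ) a) = 0
      linarith) b₀ (e v)
  let T : ℝ × B × ℝ →ₗ[ℝ] EuclideanSpace ℝ (Fin n) := e.symm.toLinearMap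
  refine ⟨fun t => e.symm (y t), by simp [hy0], fun t => ?_⟩
  have h1 : HasDerivAt (fun t => T (y t)) _ t :=
    T.toContinuousLinearMap.hasFDerivAt.comp_hasDerivAt t (hy t)
  have h2 : -(m.prod (e.symm (y t)) (e.symm (y t))) =
      e.symm (-doubleExtProd m₀ ξ D b₀ (y t) (y t)) := by
    rw [map_neg, e.eq_symm_apply.2 (apply_prod_eq_doubleExtProd hskew he hm _ _)]
    simp only [LinearEquiv.apply_symm_apply]
  rw [h2]
  exact h1

theorem IsDoubleExtension.isComplete {g : Type u} [LieRing g] [LieAlgebra ℝ g] {m : LieMetric g}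
    {B : Type*} [LieRing B] [LieAlgebra ℝ B] [FiniteDimensional ℝ B] {m₀ : LieMetric B}
    {ξ D : Module.End ℝ B} {b₀ : B} (hd : m.IsDoubleExtension m₀ ξ D 0 b₀)
    (hskew : m₀.IsSkew (D - ξ)) (hR : m₀.IsRiemannian) : IsComplete.{u, v} m := by
  intro n G _ _ _ _ _ m' φ hφ p w
  obtain ⟨e, he, hm⟩ := hd
  have hd' : m'.IsDoubleExtension m₀ ξ D 0 b₀ :=
    ⟨φ.toLinearEquiv.trans e, fun u w => by
      have h := he (φ u) (φ w)
      rw [← LieEquiv.map_lie] at h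
      exact h, fun u w => by
      rw [← hφ, hm]
      rfl⟩
  obtain ⟨x, hx0, hx⟩ := hd'.exists_forall_hasDerivAt hskew hR w
  obtain ⟨γ, hγ0, hγ⟩ := exists_forall_hasMFDerivAt_mulInvariantVectorField
    (contDiff_one_of_hasDerivAt_quadratic (F := EuclideanSpace ℝ (Fin n)) m'.prod hx) p
  exact ⟨γ, x, hγ0, hx0, hγ, hx⟩

end LieMetric

end

theorem theorem2p1 {g : Type u} [LieRing g] [LieAlgebra ℝ g] [FiniteDimensional ℝ g]
    (m : LieMetric g) (hL : m.IsLorentzian) (hZ : m.HasDegenerateCenter) :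
    (m.IsFlat ↔
      ∃ (B : Type u) (_ : LieRing B) (_ : LieAlgebra ℝ B) (_ : FiniteDimensional ℝ B)
        (m₀ : LieMetric B) (ξ D : Module.End ℝ B) (b₀ : B),
        m₀.IsRiemannian ∧ m₀.IsFlat ∧ m₀.IsAdmissible ξ D 0 b₀ ∧ (D, b₀) ≠ (0, 0) ∧
        m.IsDoubleExtension m₀ ξ D 0 b₀) ∧
    (m.IsFlat → IsUnimodularLieAlgebra g ∧ LieMetric.IsComplete.{u, v} m) := by
  refine ⟨⟨fun hf => hf.exists_isDoubleExtension hL hZ, ?_⟩, fun hf => ?_⟩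
  · rintro ⟨B, _, _, _, m₀, ξ, D, b₀, -, hf₀, hadm, -, e, he, hm⟩
    refine (LieMetric.isFlat_iff_of_doubleExt hadm.skew he hm).2
      ⟨hf₀, hadm.cocycle, fun a => ?_, hadm.compat⟩
    simpa [Ring.lie_def, sq] using LinearMap.congr_fun hadm.commutator a
  · obtain ⟨B, _, _, _, m₀, ξ, D, b₀, hR, hf₀, hadm, -, hd⟩ := hf.exists_isDoubleExtension hL hZ
    exact ⟨hd.isUnimodular hadm hf₀ hR, hd.isComplete hadm.skew hR⟩
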